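/- A graph here is a finite, undirected, simple graph. Co-graphs are the graphs obtained from one-vertex graphs by repeatedly forming disjoint unions $G_1\cup G_2$ and joins $G_1+G_2$ (the disjoint union together with all edges between $G_1$ and $G_2$). A co-tree of a co-graph $G$ is a binary tree whose leaves are the vertices of $G$ and whose inner nodes are labelled $\cup$ or $+$ and describe such a construction of $G$. A nonedge $e$ of $G$ is $\chi$-unfrozen if $\chi(G+e)=\chi(G)$, and $\chi$-frozen otherwise, where $G+e$ is $G$ with the edge $e$ added; $G$ is $\chi$-unfrozen if all its nonedges are. Theorem. (1) The problem $\chi$-Unfrozenness is in $\mathrm{P}$ for co-graphs: given (the adjacency matrix of) an arbitrary graph $G$, a deterministic Turing machine can decide in polynomial time whether $G$ is a $\chi$-unfrozen co-graph. (2) Let $T$ be a co-tree of a co-graph $G$. Label each leaf of $T$ with $1$, each $\cup$-node with the maximum, and each $+$-node with the sum, of the labels of its two children; write $c(w)$ for the label of $w$. Let $uv$ be a nonedge of $G$. Classify $uv$ at each node $w$ above both $u$ and $v$, with children $w_1,w_2$, recursively as follows. If $w$ is a $+$-node, then $u$ and $v$ lie below the same child $w_i$, and $uv$ is classified as frozen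 at $w$ if and only if it is at $w_i$. If $w$ is a $\cup$-node and $u,v$ lie below the same child $w_i$, then $uv$ is classified as frozen at $w$ if and only if it is at $w_i$ and $c(w_i)\ge c(w_{3-i})$. If $w$ is a $\cup$-node and $u,v$ lie below different children, then $uv$ is classified as frozen at $w$ if and only if $c(w_1)=c(w_2)=1$. In all other cases it is classified as unfrozen. Then $uv$ is $\chi$-frozen in $G$ if it is classified as frozen at the root of $T$, and $\chi$-unfrozen in $G$ if it is classified as unfrozen there. -/

import Mathlib

/-- The join `G + H` of two graphs: the disjoint union of `G` and `H` together with
all edges between the two parts. -/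
def graphJoin {V W : Type*} (G : SimpleGraph V) (H : SimpleGraph W) : SimpleGraph (V ⊕ W) where
  Adj
    | Sum.inl u, Sum.inl v => G.Adj u v
    | Sum.inr u, Sum.inr v => H.Adj u v
    | _, _ => True
  symm.symm
    | Sum.inl _, Sum.inl _ => G.adj_symm
    | Sum.inr _, Sum.inr _ => H.adj_symm
    | Sum.inl _, Sum.inr _ | Sum.inr _, Sum.inl _ => id
  loopless.irrefl
    | Sum.inl u => G.loopless.irrefl u
    | Sum.inr u => H.loopless.irrefl u

/-- Co-trees (co-expressions): binary trees whose inner nodes are union nodes or join nodes.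
The leaves are the vertices of the represented graph. -/
inductive CoTree : Type
  | leaf : CoTree
  | union : CoTree → CoTree → CoTree
  | join : CoTree → CoTree → CoTree

namespace CoTree

/-- The leaves of a co-tree. -/
def Vert : CoTree → Type
  | leaf => Unit
  | union a b => a.Vert ⊕ b.Vert
  | join a b => a.Vert ⊕ b.Vert

/-- The graph represented by a co-tree: a leaf is a one-vertex graph, a union node is the
disjoint union, and a join node is the join, of the graphs of the two children. -/
def graph : (t : CoTree) → SimpleGraph t.Vert
  | leaf => (⊥ : SimpleGraph Unit)
  | union a b => a.graph ⊕g b.graph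
  | join a b => graphJoin a.graph b.graph

/-- The labelling of the nodes of a co-tree with the chromatic number. -/
def chi : CoTree → ℕ
  | leaf => 1
  | union a b => max a.chi b.chi
  | join a b => a.chi + b.chi

/-- The classification of a nonedge `uv`, by recursion over the co-tree; `true` means frozen,
`false` means unfrozen. Leaves in different children of a join node are adjacent, so that the
value there is irrelevant. -/
def frozen : (t : CoTree) → t.Vert → t.Vert → Bool
  | leaf, _, _ => false
  | union a b, Sum.inl u, Sum.inl v => decide (b.chi ≤ a.chi) && a.frozen u v
  | union a b, Sum.inr u, Sum.inr v => decide (a.chi ≤ b.chi) && b.frozen u v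
  | union a b, Sum.inl _, Sum.inr _ => decide (a.chi = 1) && decide (b.chi = 1)
  | union a b, Sum.inr _, Sum.inl _ => decide (a.chi = 1) && decide (b.chi = 1)
  | join a _, Sum.inl u, Sum.inl v => a.frozen u v
  | join _ b, Sum.inr u, Sum.inr v => b.frozen u v
  | join _ _, Sum.inl _, Sum.inr _ => false
  | join _ _, Sum.inr _, Sum.inl _ => false

end CoTree

/-- Co-graphs: the graphs obtained from one-vertex graphs by disjoint unions and joins. -/
def IsCograph {V : Type*} (G : SimpleGraph V) : Prop :=
  ∃ t : CoTree, Nonempty (t.graph ≃g G)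

/-- The nonedge `uv` of `G` is `χ`-unfrozen: adding it does not change the chromatic number. -/
def ChiUnfrozenNonedge {V : Type*} (G : SimpleGraph V) (u v : V) : Prop :=
  (G ⊔ SimpleGraph.edge u v).chromaticNumber = G.chromaticNumber

/-- The nonedge `uv` of `G` is `χ`-frozen: adding it changes the chromatic number. -/
def ChiFrozenNonedge {V : Type*} (G : SimpleGraph V) (u v : V) : Prop :=
  (G ⊔ SimpleGraph.edge u v).chromaticNumber ≠ G.chromaticNumber

/-- A graph is `χ`-unfrozen if all its nonedges are `χ`-unfrozen. -/
def ChiUnfrozen {V : Type*} (G : SimpleGraph V) : Prop :=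
  ∀ u v : V, u ≠ v → ¬ G.Adj u v → ChiUnfrozenNonedge G u v

/-- Finite graphs, on the vertex sets `{0, …, n - 1}`: the instances of graph problems. -/
abbrev FinGraph : Type := Σ n : ℕ, SimpleGraph (Fin n)

open Classical in
/-- Encoding of a graph by its adjacency matrix, row by row, with the symbol `none` after
every row. -/
noncomputable def encodeGraph (G : FinGraph) : List (Option Bool) :=
  (List.finRange G.1).flatMap fun i =>
    (List.finRange G.1).map (fun j => some (decide (G.2.Adj i j))) ++ [none]

open Classical in
/-- The graph problem `L` is in `P`: some deterministic multi-stack Turing machine, started on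
the encoding of any graph `G`, outputs whether `G ∈ L`, within a number of steps that is bounded
by a polynomial in the length of the encoding. -/
def GraphProblemInP (L : Set FinGraph) : Prop :=
  Nonempty (Turing.TM2ComputableInPolyTime encodeGraph Computability.encodeBool
    (fun G => decide (G ∈ L)))

/-! Polynomial-time decision: no co-tree is built. A finite nonempty graph is a co-graph iff it has
no induced path on four vertices (`isCograph_iff`; the hard direction is Seinsche's argument,
`Splits.insert`). In such a graph, deleting any maximal independent subset from a nonempty vertex
set lowers its clique number by exactly one (`P4Free.om_sdiff`). Hence greedy deletion computes the
clique number ω and yields an optimal colouring, so χ = ω. Moreover a nonedge uv is frozen iff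
ω(N(u) ∩ N(v)) + 1 = ω(G) (`P4Free.chiUnfrozenNonedge_iff`). The algorithm therefore tests every
edge for being the middle of an induced path, and for every nonedge compares the two clique numbers
by deleting maximal independent sets from V and from N(u) ∩ N(v) in parallel.

This needs only loops over vertices, tests over pairs of vertices, and a fixed number of vertex
sets. The sets are stored as marks in the cells of the adjacency matrix, each cell carrying the
marks of both its row and its column. Every operation is then a sweep of a finite-state transducer
over the tape, and such programs compile to a machine that represents the tape by two stacks
(`Exec.steps`).

Classification: induction over the co-tree, with the exact value of χ(G + uv) as the claim
(`chromaticNumber_sup_edge`). χ is a maximum at unions and a sum at joins. A new edge between the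
two sides of a union matters only if both sides are edgeless, because the colours of one side can be
permuted. -/

/-! ### Sweep programs and their compilation to multi-stack Turing machines -/

namespace Sweep

open Turing

/-- Programs that work on a memory cell in `σ` and a tape of cells in `C` by sweeping over the whole
tape from left to right with a finite-state transducer. -/
inductive Prog (σ C : Type) : Type
  | sweep (f : σ → C → σ × C) : Prog σ C
  | load (f : σ → σ) : Prog σ C
  | seq (p q : Prog σ C) : Prog σ C
  | ite (b : σ → Bool) (p q : Prog σ C) : Prog σ C
  | loop (b : σ → Bool) (p : Prog σ C) : Prog σ C

/-- The effect of a transducer on the memory and the tape. -/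
def transduce {σ C : Type} (f : σ → C → σ × C) : σ → List C → σ × List C
  | s, [] => (s, [])
  | s, c :: w => ((transduce f (f s c).1 w).1, (f s c).2 :: (transduce f (f s c).1 w).2)

theorem transduce_append {σ C : Type} (f : σ → C → σ × C) (s : σ) (w w' : List C) :
    transduce f s (w ++ w') =
      ((transduce f (transduce f s w).1 w').1,
        (transduce f s w).2 ++ (transduce f (transduce f s w).1 w').2) := by
  induction w generalizing s with
  | nil => rfl
  | cons c w ih => simp [transduce, ih]

theorem length_transduce {σ C : Type} (f : σ → C → σ × C) (s : σ) (w : List C) :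
    (transduce f s w).2.length = w.length := by
  induction w generalizing s with
  | nil => rfl
  | cons c w ih => simp [transduce, ih]

/-- Big-step semantics: `Exec p x y t` says that `p` takes the memory and tape `x` to `y` in
`t` machine steps. -/
inductive Exec {σ C : Type} : Prog σ C → σ × List C → σ × List C → ℕ → Prop
  -- One pass to the right and one back, each with an extra step that finds its stack empty.
  | sweep (f s w) : Exec (.sweep f) (s, w) (transduce f s w) (2 * w.length + 2)
  | load (f s w) : Exec (.load f) (s, w) (f s, w) 1
  | seq {p q x y z t t'} : Exec p x y t → Exec q y z t' → Exec (.seq p q) x z (t + t')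
  | ite_true {b p q x y t} : b x.1 = true → Exec p x y t → Exec (.ite b p q) x y (1 + t)
  | ite_false {b p q x y t} : b x.1 = false → Exec q x y t → Exec (.ite b p q) x y (1 + t)
  | loop_false {b p x} : b x.1 = false → Exec (.loop b p) x x 1
  | loop_true {b p x y z t t'} : b x.1 = true → Exec p x y t → Exec (.loop b p) y z t' →
      Exec (.loop b p) x z (1 + (t + t'))

/-- Bounds the time for clearing the tape at the end by the length of the input. -/
theorem Exec.length_eq {σ C : Type} {p : Prog σ C} {x y : σ × List C} {t : ℕ}
    (h : Exec p x y t) : y.2.length = x.2.length := by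
  induction h with
  | sweep f s w => exact length_transduce f s w
  | load | loop_false => rfl
  | seq _ _ ih ih' => exact ih'.trans ih
  | ite_true _ _ ih | ite_false _ _ ih => exact ih
  | loop_true _ _ _ ih ih' => exact ih'.trans ih

/-- The labels of the machine code of a program. -/
def Prog.Lab {σ C : Type} : Prog σ C → Type
  | sweep _ => Bool
  | load _ => Unit
  | seq p q => p.Lab ⊕ q.Lab
  | ite _ p q => Option (p.Lab ⊕ q.Lab)
  | loop _ p => Option p.Lab

instance Prog.instFintypeLab {σ C : Type} : (p : Prog σ C) → Fintype p.Lab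
  | sweep _ => inferInstanceAs (Fintype Bool)
  | load _ => inferInstanceAs (Fintype Unit)
  | seq p q =>
    have := p.instFintypeLab
    have := q.instFintypeLab
    inferInstanceAs (Fintype (p.Lab ⊕ q.Lab))
  | ite _ p q =>
    have := p.instFintypeLab
    have := q.instFintypeLab
    inferInstanceAs (Fintype (Option (p.Lab ⊕ q.Lab)))
  | loop _ p =>
    have := p.instFintypeLab
    inferInstanceAs (Fintype (Option p.Lab))

/-- The entry point of the machine code of a program. -/
def Prog.entry {σ C : Type} : (p : Prog σ C) → p.Lab
  | sweep _ => true
  | load _ => ()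
  | seq p _ => Sum.inl p.entry
  | ite _ _ _ => none
  | loop _ _ => none

/-- The contents of the machine: the input, the tape to the right and to the left of the head,
and the output. -/
inductive Stk : Type
  | inp | right | left | out
  deriving DecidableEq

instance : Fintype Stk where
  elems := {.inp, .right, .left, .out}
  complete k := by cases k <;> simp

/-- The stack alphabets. -/
def Sym (I C : Type) : Stk → Type
  | .inp => I
  | .right => C
  | .left => C
  | .out => Bool

/-- The contents of the stacks. -/
def contents {I C : Type} (i : List I) (r l : List C) (o : List Bool) : ∀ k, List (Sym I C k)
  | .inp => i
  | .right => r
  | .left => l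
  | .out => o

/-! ### Counting machine steps. -/

section steps
variable {I σ C L : Type}

/-- The machine `M` goes from configuration `c` to `c'` in `t` steps. -/
def Steps (M : L → TM2.Stmt (Sym I C) L (σ × Option C)) (t : ℕ)
    (c c' : TM2.Cfg (Sym I C) L (σ × Option C)) : Prop :=
  (flip bind (TM2.step M))^[t] (some c) = some c'

variable {M : L → TM2.Stmt (Sym I C) L (σ × Option C)}

theorem Steps.refl (c) : Steps M 0 c c := rfl

theorem Steps.trans {t t' : ℕ} {a b c} (h : Steps M t a b) (h' : Steps M t' b c) :
    Steps M (t + t') a c := by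
  unfold Steps at *
  rw [add_comm, Function.iterate_add_apply, h, h']

theorem Steps.one {l : L} {v : σ × Option C} {S : ∀ k, List (Sym I C k)} :
    Steps M 1 ⟨some l, v, S⟩ (TM2.stepAux (M l) v S) := rfl

theorem Steps.head {t : ℕ} {l : L} {v : σ × Option C} {S : ∀ k, List (Sym I C k)} {b c}
    (h : TM2.stepAux (M l) v S = b) (h' : Steps M t b c) : Steps M (t + 1) ⟨some l, v, S⟩ c := by
  rw [add_comm]
  exact Steps.trans (b := b) (h ▸ Steps.one) h'

theorem cfg_congr {l : Option L} {v : σ × Option C} {S S' : ∀ k, List (Sym I C k)}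
    (h : ∀ k, S k = S' k) : (⟨l, v, S⟩ : TM2.Cfg (Sym I C) L (σ × Option C)) = ⟨l, v, S'⟩ := by
  rw [funext h]

end steps

/-! ### Compilation of programs and its correctness. -/

section compile
variable {I σ C L : Type} [Inhabited C]

/-- Move the head back to the start of the tape, then go to `exit`. -/
def rewind (self exit : L) : TM2.Stmt (Sym I C) L (σ × Option C) :=
  .pop Stk.left (fun v c => (v.1, c)) <|
    .branch (fun v => v.2.isSome)
      -- The default is never pushed: this branch is taken only if a cell has been popped.
      (.push Stk.right (fun v => v.2.getD default) <| .goto fun _ => self)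
      (.goto fun _ => exit)

/-- The machine code of a program, with its labels embedded into `L` by `emb`, and with `exit` as
the label at which the execution continues. -/
def Prog.code : (p : Prog σ C) → (p.Lab → L) → L → p.Lab → TM2.Stmt (Sym I C) L (σ × Option C)
  | sweep f, emb, exit => fun l => match l with
    | true => .pop Stk.right (fun v c => match c with
          | none => (v.1, none)
          | some c => ((f v.1 c).1, some (f v.1 c).2)) <|
        .branch (fun v => v.2.isSome)
          (.push Stk.left (fun v => v.2.getD default) <| .goto fun _ => emb true)
          (.goto fun _ => emb false)
    | false => rewind (emb false) exit
  | load f, _, exit => fun _ => .load (fun v => (f v.1, v.2)) <| .goto fun _ => exit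
  | seq p q, emb, exit => fun l => match l with
    | Sum.inl l => p.code (fun l => emb (Sum.inl l)) (emb (Sum.inr q.entry)) l
    | Sum.inr l => q.code (fun l => emb (Sum.inr l)) exit l
  | ite b p q, emb, exit => fun l => match l with
    | none => .branch (fun v => b v.1)
        (.goto fun _ => emb (some (Sum.inl p.entry))) (.goto fun _ => emb (some (Sum.inr q.entry)))
    | some (Sum.inl l) => p.code (fun l => emb (some (Sum.inl l))) exit l
    | some (Sum.inr l) => q.code (fun l => emb (some (Sum.inr l))) exit l
  | loop b p, emb, exit => fun l => match l with
    | none => .branch (fun v => b v.1) (.goto fun _ => emb (some p.entry)) (.goto fun _ => exit)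
    | some l => p.code (fun l => emb (some l)) (emb none) l

variable {M : L → TM2.Stmt (Sym I C) L (σ × Option C)}

theorem steps_rewind {self exit : L} (hM : M self = rewind self exit) (s : σ) (x : Option C)
    (i : List I) (l r : List C) (o : List Bool) :
    Steps M (l.length + 1) ⟨some self, (s, x), contents i r l o⟩
      ⟨some exit, (s, none), contents i (l.reverse ++ r) [] o⟩ := by
  induction l generalizing r x with
  | nil =>
    refine Steps.head ?_ (Steps.refl _)
    rw [hM]
    exact cfg_congr fun k => by cases k <;> rfl
  | cons c l ih =>
    refine Steps.head (b := ⟨some self, (s, some c), contents i (c :: r) l o⟩) ?_ ?_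
    · rw [hM]
      exact cfg_congr fun k => by cases k <;> rfl
    · simpa using ih (some c) (c :: r)

/-- The rewritten cells pile up on the left stack in reverse order; `rewind` undoes the reversal. -/
theorem steps_sweep {emb : Bool → L} {exit : L} {f : σ → C → σ × C}
    (hM : ∀ l, M (emb l) = (Prog.sweep f).code emb exit l) (s : σ) (x : Option C)
    (i : List I) (l r : List C) (o : List Bool) :
    Steps M (r.length + 1) ⟨some (emb true), (s, x), contents i r l o⟩
      ⟨some (emb false), ((transduce f s r).1, none),
        contents i [] ((transduce f s r).2.reverse ++ l) o⟩ := by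
  induction r generalizing l s x with
  | nil =>
    refine Steps.head ?_ (Steps.refl _)
    rw [hM]
    exact cfg_congr fun k => by cases k <;> rfl
  | cons c r ih =>
    refine Steps.head
      (b := ⟨some (emb true), ((f s c).1, some (f s c).2), contents i r ((f s c).2 :: l) o⟩) ?_ ?_
    · rw [hM]
      exact cfg_congr fun k => by cases k <;> rfl
    · simpa [transduce] using ih (f s c).1 (some (f s c).2) ((f s c).2 :: l)

/-- Induction on the execution. The exit label has to vary: the first half of a sequence exits to
the entry of the second, and a loop body exits to the head of its loop. Between programs the buffer
for the popped cell is `none` and the head is at the left end. -/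
theorem Exec.steps {p : Prog σ C} {x y : σ × List C} {t : ℕ} (h : Exec p x y t)
    {emb : p.Lab → L} {exit : L} (hM : ∀ l, M (emb l) = p.code emb exit l)
    (i : List I) (o : List Bool) :
    Steps M t ⟨some (emb p.entry), (x.1, none), contents i x.2 [] o⟩
      ⟨some exit, (y.1, none), contents i y.2 [] o⟩ := by
  induction h generalizing exit with
  | sweep f s w =>
    have h₁ := steps_sweep hM s none i [] w o
    have h₂ := steps_rewind (M := M) (hM false) (transduce f s w).1 none i
      ((transduce f s w).2.reverse ++ []) [] o
    have := h₁.trans h₂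
    simp only [List.append_nil, List.reverse_reverse, List.length_reverse,
      length_transduce] at this
    rw [show 2 * w.length + 2 = w.length + 1 + (w.length + 1) by ring]
    exact this
  | load f s w =>
    refine Steps.head ?_ (Steps.refl _)
    rw [hM]
    rfl
  | @seq p q x y z t t' _ _ ih ih' =>
    exact (ih (emb := fun l => emb (Sum.inl l)) fun l => hM (Sum.inl l)).trans
      (ih' (emb := fun l => emb (Sum.inr l)) fun l => hM (Sum.inr l))
  | @ite_true b p q x y t hb _ ih =>
    rw [add_comm]
    refine Steps.head ?_
      (ih (emb := fun l => emb (some (Sum.inl l))) fun l => hM (some (Sum.inl l)))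
    have := hM none
    simp only [Prog.code] at this
    simp only [Prog.entry, this, TM2.stepAux, hb, cond_true]
  | @ite_false b p q x y t hb _ ih =>
    rw [add_comm]
    refine Steps.head ?_
      (ih (emb := fun l => emb (some (Sum.inr l))) fun l => hM (some (Sum.inr l)))
    have := hM none
    simp only [Prog.code] at this
    simp only [Prog.entry, this, TM2.stepAux, hb, cond_false]
  | @loop_false b p x hb =>
    refine Steps.head ?_ (Steps.refl _)
    have := hM none
    simp only [Prog.code] at this
    simp only [Prog.entry, this, TM2.stepAux, hb, cond_false]
  | @loop_true b p x y z t t' hb _ _ ih ih' =>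
    rw [add_comm]
    refine Steps.head ?_ ((ih (emb := fun l => emb (some l)) fun l => hM (some l)).trans (ih' hM))
    have := hM none
    simp only [Prog.code] at this
    simp only [Prog.entry, this, TM2.stepAux, hb, cond_true]

end compile

/-! ### The decision machine: input, program, output. -/

section machine
variable {I σ C : Type} [Inhabited C]

/-- The statements of the decision machine of a program: the program itself, and the phases
that read the input, rewind the tape, and clear the tape and give the answer. -/
def Prog.machine (p : Prog σ C) (ini : I → C) (s₀ : σ) (ans : σ → Bool) :
    Fin 3 ⊕ p.Lab → TM2.Stmt (Sym I C) (Fin 3 ⊕ p.Lab) (σ × Option C)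
  | Sum.inl 0 => .pop Stk.inp (fun v c => (v.1, c.map ini)) <|
      .branch (fun v => v.2.isSome)
        (.push Stk.left (fun v => v.2.getD default) <| .goto fun _ => Sum.inl 0)
        (.goto fun _ => Sum.inl 1)
  | Sum.inl 1 => rewind (Sum.inl 1) (Sum.inr p.entry)
  | Sum.inl 2 => .pop Stk.right (fun v c => (v.1, c)) <|
      .branch (fun v => v.2.isSome) (.goto fun _ => Sum.inl 2) <|
        .push Stk.out (fun v => ans v.1) <| .load (fun _ => (s₀, none)) .halt
  | Sum.inr l => p.code Sum.inr (Sum.inl 2) l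

variable (p : Prog σ C) (ini : I → C) (s₀ : σ) (ans : σ → Bool)

theorem steps_read (x : Option C) (i : List I) (l : List C) :
    Steps (p.machine ini s₀ ans) (i.length + 1) ⟨some (Sum.inl 0), (s₀, x), contents i [] l []⟩
      ⟨some (Sum.inl 1), (s₀, none), contents [] [] ((i.map ini).reverse ++ l) []⟩ := by
  induction i generalizing l x with
  | nil => exact Steps.head (cfg_congr fun k => by cases k <;> rfl) (Steps.refl _)
  | cons c i ih =>
    refine Steps.head
      (b := ⟨some (Sum.inl 0), (s₀, some (ini c)), contents i [] (ini c :: l) []⟩) ?_ ?_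
    · exact cfg_congr fun k => by cases k <;> rfl
    · simpa using ih (some (ini c)) (ini c :: l)

/-- `haltList` requires the initial memory and empty stacks apart from the output, hence the
clearing and the reset to `s₀`. -/
theorem steps_clear (s : σ) (x : Option C) (r : List C) :
    Steps (p.machine ini s₀ ans) (r.length + 1) ⟨some (Sum.inl 2), (s, x), contents [] r [] []⟩
      ⟨none, (s₀, none), contents [] [] [] [ans s]⟩ := by
  induction r generalizing x with
  | nil => exact Steps.head (cfg_congr fun k => by cases k <;> rfl) (Steps.refl _)
  | cons c r ih => exact Steps.head (cfg_congr fun k => by cases k <;> rfl) (ih (some c))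

/-- A problem that is decided by a sweep program in polynomial time is decided by a
Turing machine in polynomial time. -/
theorem computableInPolyTime_of_exec [Fintype I] [Fintype σ] [Fintype C] {α : Type}
    (ea : α → List I) (f : α → Bool) (P : Polynomial ℕ)
    (h : ∀ a, ∃ s w t, t ≤ P.eval (ea a).length ∧
      Exec p (s₀, (ea a).map ini) (s, w) t ∧ ans s = f a) :
    Nonempty (TM2ComputableInPolyTime ea Computability.encodeBool f) := by
  -- Reading, rewinding and clearing take one more step each than the length of the input.
  have key : ∀ a, ∃ t ≤ (P + 3 * Polynomial.X + 3 : Polynomial ℕ).eval (ea a).length,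
      Steps (p.machine ini s₀ ans) t ⟨some (Sum.inl 0), (s₀, none), contents (ea a) [] [] []⟩
        ⟨none, (s₀, none), contents [] [] [] [f a]⟩ := by
    intro a
    obtain ⟨s, w, t, ht, hp, hs⟩ := h a
    have h₁ := steps_read p ini s₀ ans none (ea a) []
    have h₂ := steps_rewind (M := p.machine ini s₀ ans) (self := Sum.inl 1)
      (exit := Sum.inr p.entry) rfl s₀ none [] (((ea a).map ini).reverse ++ []) [] []
    have h₃ := hp.steps (M := p.machine ini s₀ ans) (emb := Sum.inr) (exit := Sum.inl 2)
      (fun _ => rfl) [] []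
    have h₄ := steps_clear p ini s₀ ans s none w
    have hw := hp.length_eq
    simp only [List.append_nil, List.reverse_reverse, List.length_reverse,
      List.length_map] at h₁ h₂ h₃ h₄ hw
    refine ⟨_, ?_, hs ▸ ((h₁.trans h₂).trans h₃).trans h₄⟩
    simp only [Polynomial.eval_add, Polynomial.eval_mul, Polynomial.eval_X,
      Polynomial.eval_ofNat, hw]
    omega
  choose t ht hst using key
  let _ : Fintype (Sym I C Stk.inp) := inferInstanceAs (Fintype I)
  let tm : FinTM2 := ⟨Stk.inp, Stk.out, Sym I C, Fin 3 ⊕ p.Lab, Sum.inl 0, σ × Option C, (s₀, none),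
    p.machine ini s₀ ans⟩
  refine ⟨⟨⟨tm, Equiv.refl I, Equiv.refl Bool⟩, P + 3 * Polynomial.X + 3,
    fun a => ⟨⟨t a, ?_⟩, ht a⟩⟩⟩
  have e₁ : initList tm ((ea a).map id) =
      ⟨some (Sum.inl 0), (s₀, none), contents (ea a) [] [] []⟩ :=
    cfg_congr fun k => by
      cases k
      · exact List.map_id (ea a)
      all_goals rfl
  have e₂ : haltList tm [f a] = ⟨none, (s₀, none), contents [] [] [] [f a]⟩ :=
    cfg_congr fun k => by cases k <;> rfl
  exact (congrArg (fun c => (flip bind tm.step)^[t a] (some c)) e₁).trans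
    (Eq.trans (hst a) (congrArg some e₂.symm))

end machine

end Sweep

/-! ### Graph programs with vertex sets -/

namespace Sweep

/-- A cell of the tape: an entry of the adjacency matrix with the marks of its row and of its
column, or the end of a row. -/
abbrev Cell (ι : Type) : Type := Option (Bool × (ι → Bool) × (ι → Bool))

/-- The memory: two flags and three bits of scratch space. -/
abbrev Mem : Type := (Bool × Bool) × (Bool × Bool × Bool)

/-- The environment of a graph program: two flags and, for every vertex, its membership in
the vertex sets `ι`. -/
structure Env (ι : Type) where
  flag : Bool
  ok : Bool
  marks : ℕ → ι → Bool

variable {ι : Type}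

/-- The cells of the row `a`, up to the column `m`. -/
def row (A : ℕ → ℕ → Bool) (X : ℕ → ι → Bool) (a m : ℕ) : List (Cell ι) :=
  (List.range m).map fun b => some (A a b, X a, X b)

/-- The first `m` rows of the tape of a graph with `n` vertices. -/
def rows (n : ℕ) (A : ℕ → ℕ → Bool) (X : ℕ → ι → Bool) (m : ℕ) : List (Cell ι) :=
  (List.range m).flatMap fun a => row A X a n ++ [none]

theorem row_succ (A : ℕ → ℕ → Bool) (X : ℕ → ι → Bool) (a m : ℕ) :
    row A X a (m + 1) = row A X a m ++ [some (A a m, X a, X m)] := by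
  simp [row, List.range_succ]

theorem rows_succ (n : ℕ) (A : ℕ → ℕ → Bool) (X : ℕ → ι → Bool) (m : ℕ) :
    rows n A X (m + 1) = rows n A X m ++ (row A X m n ++ [none]) := by
  simp [rows, List.range_succ]

theorem length_rows (n : ℕ) (A : ℕ → ℕ → Bool) (X : ℕ → ι → Bool) (m : ℕ) :
    (rows n A X m).length = m * (n + 1) := by
  induction m with
  | zero => simp [rows]
  | succ m ih =>
    rw [rows_succ, List.length_append, ih]
    simp [row]
    ring

/-- The memory and tape that represent an environment. -/
def Env.conf (n : ℕ) (A : ℕ → ℕ → Bool) (e : Env ι) : Mem × List (Cell ι) :=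
  (((e.flag, e.ok), (false, false, false)), rows n A e.marks n)

/-- Marks of numbers from `n` on do not occur on the tape. Operations can thus be specified on all
of ℕ, and a pointer may run past the last vertex. -/
theorem Env.conf_congr {n : ℕ} {A : ℕ → ℕ → Bool} {e e' : Env ι} (hf : e.flag = e'.flag)
    (ho : e.ok = e'.ok) (hm : ∀ x < n, e.marks x = e'.marks x) : e.conf n A = e'.conf n A := by
  simp only [Env.conf, hf, ho, rows, row]
  congr 1
  refine List.flatMap_congr fun a ha => ?_
  congr 1
  refine List.map_congr_left fun b hb => ?_
  rw [hm a (List.mem_range.1 ha), hm b (List.mem_range.1 hb)]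

/-- The denotations of graph programs: transformations of the environment, given the graph. -/
abbrev Op (ι : Type) : Type := ℕ → (ℕ → ℕ → Bool) → Env ι → Env ι

/-- The program `p` computes `F` in polynomial time. -/
def Runs (p : Prog Mem (Cell ι)) (F : Op ι) : Prop :=
  ∃ P : Polynomial ℕ, ∀ n A e, ∃ t ≤ P.eval n, Exec p (e.conf n A) ((F n A e).conf n A) t

/-- `F` is computed by some program in polynomial time. -/
def Feasible (F : Op ι) : Prop := ∃ p, Runs p F

/-- Set the flag if some pair of vertices satisfies `P`, which is given the adjacency of the
vertices and the sets that they belong to. -/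
def Op.test (P : Bool → (ι → Bool) → (ι → Bool) → Bool) : Op ι := fun n A e =>
  ⟨(List.range n).any fun a => (List.range n).any fun b => P (A a b) (e.marks a) (e.marks b),
    e.ok, e.marks⟩

/-- Change the sets of every vertex by `g`. -/
def Op.apply (g : Bool → (ι → Bool) → ι → Bool) : Op ι := fun _ _ e =>
  { e with marks := fun x => g e.flag (e.marks x) }

/-- Change the flag `ok`. -/
def Op.setOk (h : Bool → Bool → Bool) : Op ι := fun _ _ e => { e with ok := h e.flag e.ok }

/-- Composition. -/
def Op.seq (F G : Op ι) : Op ι := fun n A e => G n A (F n A e)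

/-- Branching with respect to the flag. -/
def Op.ite (F G : Op ι) : Op ι := fun n A e => if e.flag = true then F n A e else G n A e

theorem transduce_map {σ C : Type} (g : C → C) (s : σ) (w : List C) :
    transduce (fun s c => (s, g c)) s w = (s, w.map g) := by
  induction w with
  | nil => rfl
  | cons c w ih => simp [transduce, ih]

theorem transduce_any {C : Type} (P : C → Bool) (x y : Bool) (s : Bool × Bool × Bool)
    (w : List C) :
    transduce (fun (s : Mem) c => (((s.1.1 || P c, s.1.2), s.2), c)) ((x, y), s) w =
      (((x || w.any P, y), s), w) := by
  induction w generalizing x with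
  | nil => simp [transduce]
  | cons c w ih => simp [transduce, ih, Bool.or_assoc]

/-- The common form of the basic operations: the loads before and after the sweep prepare the memory
and clear the scratch bits. The tape has n(n + 1) cells. -/
theorem Runs.sweep_load {F : Op ι} {f : Mem → Cell ι → Mem × Cell ι} {g h : Mem → Mem}
    (H : ∀ n A (e : Env ι), (F n A e).conf n A =
      (h (transduce f (g (e.conf n A).1) (e.conf n A).2).1,
        (transduce f (g (e.conf n A).1) (e.conf n A).2).2)) :
    Runs (.seq (.load g) (.seq (.sweep f) (.load h))) F := by
  refine ⟨2 * (Polynomial.X * (Polynomial.X + 1)) + 4, fun n A e => ?_⟩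
  rw [H]
  refine ⟨_, ?_, .seq (.load _ _ _) (.seq (.sweep _ _ _) (.load _ _ _))⟩
  simp [length_rows]
  omega

/-- One sweep suffices since each cell shows the marks of both of its vertices, and every pair of
vertices has a cell. -/
theorem Feasible.test (P : Bool → (ι → Bool) → (ι → Bool) → Bool) : Feasible (Op.test P) := by
  refine ⟨_, Runs.sweep_load (f := fun s c => (((s.1.1 ||
    c.elim false (fun c => P c.1 c.2.1 c.2.2), s.1.2), s.2), c))
    (g := fun s => ((false, s.1.2), s.2)) (h := id) fun n A e => ?_⟩
  rw [transduce_any]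
  simp [Env.conf, Op.test, rows, row, List.any_flatMap, Function.comp_def]

theorem Feasible.mapMarks (g : (ι → Bool) → ι → Bool) :
    Feasible fun _ _ e => ⟨e.flag, e.ok, fun x => g (e.marks x)⟩ := by
  refine ⟨_, Runs.sweep_load (f := fun s c => (s, c.map fun c => (c.1, g c.2.1, g c.2.2)))
    (g := id) (h := id) fun n A e => ?_⟩
  rw [transduce_map]
  simp [Env.conf, rows, row, List.map_flatMap, Function.comp_def]

theorem Feasible.setOk (h : Bool → Bool → Bool) : Feasible (ι := ι) (Op.setOk h) :=
  ⟨.load fun s => ((s.1.1, h s.1.1 s.1.2), s.2), 1, fun n A e => ⟨1, by simp, .load _ _ _⟩⟩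

theorem Feasible.seq {F G : Op ι} (hF : Feasible F) (hG : Feasible G) : Feasible (F.seq G) := by
  obtain ⟨p, P, hP⟩ := hF
  obtain ⟨q, Q, hQ⟩ := hG
  refine ⟨.seq p q, P + Q, fun n A e => ?_⟩
  obtain ⟨t, ht, hp⟩ := hP n A e
  obtain ⟨t', ht', hq⟩ := hQ n A (F n A e)
  exact ⟨t + t', by simp; omega, .seq hp hq⟩

theorem Feasible.ite {F G : Op ι} (hF : Feasible F) (hG : Feasible G) : Feasible (F.ite G) := by
  obtain ⟨p, P, hP⟩ := hF
  obtain ⟨q, Q, hQ⟩ := hG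
  refine ⟨.ite (fun s => s.1.1) p q, P + Q + 1, fun n A e => ?_⟩
  cases hf : e.flag
  · obtain ⟨t, ht, hp⟩ := hQ n A e
    refine ⟨1 + t, by simp; omega, .ite_false (by simp [Env.conf, hf]) ?_⟩
    simpa [Op.ite, hf] using hp
  · obtain ⟨t, ht, hp⟩ := hP n A e
    refine ⟨1 + t, by simp; omega, .ite_true (by simp [Env.conf, hf]) ?_⟩
    simpa [Op.ite, hf] using hp

theorem Feasible.apply (g : Bool → (ι → Bool) → ι → Bool) : Feasible (Op.apply g) := by
  convert (Feasible.mapMarks (g true)).ite (Feasible.mapMarks (g false)) using 1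
  funext n A e
  cases hf : e.flag <;> simp [Op.ite, Op.apply, hf]

/-! ### Loops over all vertices by means of a moving pointer. -/

section loops
variable [DecidableEq ι]

/-- Replace the elements of the set `r` by their successors, and add `0` if `b` is `true`. -/
def Op.shift (b : Bool) (r : ι) : Op ι := fun _ _ e =>
  ⟨e.flag, e.ok, fun x => Function.update (e.marks x) r (x.casesOn b fun x => e.marks x r)⟩

/-- The transducer for `Op.shift`. The three bits of scratch space hold the new marks of the
current column and row, and the old mark of the current row. -/
def shiftStep (b : Bool) (r : ι) (s : Mem) : Cell ι → Mem × Cell ι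
  | none => ((s.1, (b, s.2.2.2, false)), none)
  | some c => ((s.1, (c.2.2 r, s.2.2.1, c.2.1 r)),
      some (c.1, Function.update c.2.1 r s.2.2.1, Function.update c.2.2 r s.2.1))

/-- The new mark of a column is the old mark of the column before it, so one bit of delay suffices.
The old mark of the row, needed for the next row, is known only after the first cell; until then its
bit is still `z`. -/
theorem transduce_shiftStep_row (b : Bool) (r : ι) (A : ℕ → ℕ → Bool) (e : Env ι) (a m : ℕ)
    (s : Bool × Bool) (z : Bool) :
    transduce (shiftStep b r) (s, (b, (Op.shift b r m A e).marks a r, z)) (row A e.marks a m) =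
      ((s, ((Op.shift b r m A e).marks m r, (Op.shift b r m A e).marks a r,
        if m = 0 then z else e.marks a r)), row A (Op.shift b r m A e).marks a m) := by
  induction m with
  | zero => simp [row, transduce, Op.shift]
  | succ m ih =>
    simp only [row_succ, transduce_append]
    rw [show Op.shift b r (m + 1) A e = Op.shift b r m A e from rfl, ih]
    cases m <;> simp [transduce, shiftStep, Op.shift]

theorem transduce_shiftStep_rows (b : Bool) (r : ι) (n : ℕ) (A : ℕ → ℕ → Bool) (e : Env ι) (m : ℕ)
    (hm : m ≤ n) (s : Bool × Bool) :
    transduce (shiftStep b r) (s, (b, b, false)) (rows n A e.marks m) =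
      ((s, (b, (Op.shift b r n A e).marks m r, false)), rows n A (Op.shift b r n A e).marks m) := by
  induction m with
  | zero => simp [rows, transduce, Op.shift]
  | succ m ih =>
    simp only [rows_succ, transduce_append]
    rw [ih (by omega)]
    simp only [transduce_shiftStep_row]
    -- Rows are nonempty, so the old mark of the row has been read when the row ends.
    have : n ≠ 0 := by omega
    simp [transduce, shiftStep, Op.shift, this]

theorem Feasible.shift (b : Bool) (r : ι) : Feasible (Op.shift b r) := by
  refine ⟨_, Runs.sweep_load (f := shiftStep b r)
    (g := fun s => (s.1, (b, b, false))) (h := fun s => (s.1, (false, false, false)))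
    fun n A e => ?_⟩
  simp only [Env.conf]
  rw [transduce_shiftStep_rows b r n A e n le_rfl]
  rfl

/-- `F` does not change the set `r`. -/
def Op.Preserves (r : ι) (F : Op ι) : Prop := ∀ n A e x, (F n A e).marks x r = e.marks x r

/-- The environment at the start of a pass of a loop: the set `r` is `{i}`. -/
def Env.enter (r : ι) (i : ℕ) (e : Env ι) : Env ι :=
  ⟨true, e.ok, fun x => Function.update (e.marks x) r (x == i)⟩

/-- The environment at the end of a loop: the set `r` is empty. -/
def Env.leave (r : ι) (e : Env ι) : Env ι :=
  ⟨false, e.ok, fun x => Function.update (e.marks x) r false⟩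

/-- A loop over all vertices, with the set `r` as a pointer to the current vertex. -/
def Op.forEach (r : ι) (F : Op ι) : Op ι := fun n A e =>
  ((List.range n).foldl (fun e i => F n A (e.enter r i)) e).leave r

/-- Testing whether the pointer set is nonempty sets the flag iff `i < n`, so the flag serves as
loop condition. A pointer beyond the last vertex is invisible on the tape, which is the state after
the loop. -/
theorem conf_test_enter {r : ι} {i n : ℕ} {A : ℕ → ℕ → Bool} {e e' : Env ι}
    (hr : ∀ x, e.marks x r = (x == i)) (ho : e.ok = e'.ok)
    (hm : ∀ x j, j ≠ r → e.marks x j = e'.marks x j) :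
    (Op.test (fun _ x _ => x r) n A e).conf n A =
      (if i < n then e'.enter r i else e'.leave r).conf n A := by
  split_ifs with h
  · refine Env.conf_congr ?_ ho fun x _ => ?_
    · simpa [Op.test, Env.enter, hr] using ⟨h, ⟨i, h⟩⟩
    · funext j
      by_cases hj : j = r
      · simp [Op.test, Env.enter, hr, hj]
      · simp [Op.test, Env.enter, hm _ _ hj, hj]
  · refine Env.conf_congr ?_ ho fun x hx => ?_
    · have : ∀ x < n, x ≠ i := by omega
      simpa [Op.test, Env.leave, hr] using fun x hx _ _ => this x hx
    · have : x ≠ i := by omega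
      funext j
      by_cases hj : j = r
      · simp [Op.test, Env.leave, hr, hj, this]
      · simp [Op.test, Env.leave, hm _ _ hj, hj]

/-- A loop pass, with the step to the next vertex. -/
def Op.pass (r : ι) (F : Op ι) : Op ι :=
  (F.seq (Op.shift false r)).seq (Op.test fun _ x _ => x r)

theorem conf_pass {r : ι} {F : Op ι} (hF : F.Preserves r) (n : ℕ) (A : ℕ → ℕ → Bool) (i : ℕ)
    (e : Env ι) :
    (F.pass r n A (e.enter r i)).conf n A =
      (if i + 1 < n then (F n A (e.enter r i)).enter r (i + 1)
        else (F n A (e.enter r i)).leave r).conf n A := by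
  refine conf_test_enter (fun x => ?_) rfl fun x j hj => ?_
  · cases x <;> simp [Op.seq, Op.shift, hF n A, Env.enter]
  · simp [Op.seq, Op.shift, hj]

/-- Induction on the number `k` of remaining passes. Each costs at most `T` and one branching step,
and the last branching leaves the loop. -/
theorem exec_loop {r : ι} {F : Op ι} {p : Prog Mem (Cell ι)} {n : ℕ} {A : ℕ → ℕ → Bool} {T : ℕ}
    (hp : ∀ e : Env ι, ∃ t ≤ T, Exec p (e.conf n A) ((F.pass r n A e).conf n A) t)
    (hF : F.Preserves r) (i k : ℕ) (hk : i + k = n) (e : Env ι) :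
    ∃ t ≤ k * (T + 1) + 1, Exec (.loop (fun s => s.1.1) p)
      ((if i < n then e.enter r i else e.leave r).conf n A)
      ((((List.range' i k).foldl (fun e i => F n A (e.enter r i)) e).leave r).conf n A) t := by
  induction k generalizing i e with
  | zero =>
    have : ¬ i < n := by omega
    rw [if_neg this]
    exact ⟨1, by omega, .loop_false rfl⟩
  | succ k ih =>
    have : i < n := by omega
    obtain ⟨t, ht, h⟩ := hp (e.enter r i)
    obtain ⟨t', ht', h'⟩ := ih (i + 1) (by omega) (F n A (e.enter r i))
    rw [conf_pass hF] at h
    rw [if_pos this]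
    exact ⟨1 + (t + t'), by linarith, .loop_true rfl h h'⟩

theorem Feasible.forEach (r : ι) {F : Op ι} (hF : Feasible F) (hr : F.Preserves r) :
    Feasible (Op.forEach r F) := by
  obtain ⟨p, P, hp⟩ := (hF.seq (Feasible.shift false r)).seq (Feasible.test fun _ x _ => x r)
  -- Emptying `r` and shifting in `true` puts the pointer on the vertex 0.
  obtain ⟨q, Q, hq⟩ := ((Feasible.apply fun _ x => Function.update x r false).seq
    (Feasible.shift true r)).seq (Feasible.test fun _ x _ => x r)
  refine ⟨.seq q (.loop (fun s => s.1.1) p), Q + (Polynomial.X * (P + 1) + 1), fun n A e => ?_⟩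
  obtain ⟨t, ht, h⟩ := hq n A e
  obtain ⟨t', ht', h'⟩ := exec_loop (hp n A) hr 0 n (zero_add n) e
  refine ⟨t + t', by simp; omega, .seq h ?_⟩
  rw [← List.range_eq_range'] at h'
  have h₀ := conf_test_enter (r := r) (i := 0) (n := n) (A := A) (e' := e)
    (e := Op.shift true r n A (Op.apply (fun _ x => Function.update x r false) n A e))
    (fun x => by cases x <;> simp [Op.shift, Op.apply]) rfl
    (fun x j hj => by simp [Op.shift, Op.apply, hj])
  rw [← h₀] at h'
  exact h'

end loops

/-- The adjacency matrix of a graph. -/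
noncomputable def adjOf (G : FinGraph) (a b : ℕ) : Bool :=
  open Classical in decide (∃ (ha : a < G.1) (hb : b < G.1), G.2.Adj ⟨a, ha⟩ ⟨b, hb⟩)

theorem adjOf_eq_true {G : FinGraph} {i j : Fin G.1} : adjOf G i j = true ↔ G.2.Adj i j := by
  simp [adjOf]

open Classical in
theorem adjOf_coe (G : FinGraph) (i j : Fin G.1) : adjOf G i j = decide (G.2.Adj i j) := by
  rw [Bool.eq_iff_iff, adjOf_eq_true, decide_eq_true_iff]

/-- The initial environment. -/
def Env.init : Env ι := ⟨false, false, fun _ _ => false⟩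

theorem map_encodeGraph (G : FinGraph) :
    (encodeGraph G).map (Option.map fun b => (b, fun _ => false, fun _ => false)) =
      rows (ι := ι) G.1 (adjOf G) (fun _ _ => false) G.1 := by
  have h : ∀ m, List.range m = (List.finRange m).map Fin.val := by simp
  simp only [encodeGraph, rows, row, h, List.map_flatMap, List.flatMap_map, List.map_append,
    List.map_map, Function.comp_def, adjOf_coe, List.map_cons, List.map_nil, Option.map_some,
    Option.map_none]

theorem eval_mono_nat (P : Polynomial ℕ) {a b : ℕ} (h : a ≤ b) :
    P.eval a ≤ P.eval b := by
  rw [Polynomial.eval_eq_sum_range, Polynomial.eval_eq_sum_range]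
  gcongr

/-- A graph problem that is decided by a feasible graph program is in `P`. -/
theorem graphProblemInP_of_feasible [Fintype ι] [DecidableEq ι] {L : Set FinGraph} {F : Op ι}
    (hF : Feasible F) (h : ∀ G : FinGraph, (F G.1 (adjOf G) Env.init).ok = true ↔ G ∈ L) :
    GraphProblemInP L := by
  obtain ⟨p, P, hp⟩ := hF
  refine computableInPolyTime_of_exec p (Option.map fun b => (b, fun _ => false, fun _ => false))
    ((false, false), (false, false, false)) (fun s => s.1.2) _ _ P fun G => ?_
  obtain ⟨t, ht, H⟩ := hp G.1 (adjOf G) Env.init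
  refine ⟨((F G.1 (adjOf G) Env.init).conf G.1 (adjOf G)).1,
    ((F G.1 (adjOf G) Env.init).conf G.1 (adjOf G)).2, t,
    ht.trans (eval_mono_nat P ?_), ?_, ?_⟩
  rotate_left
  · rw [map_encodeGraph]
    exact H
  · by_cases hG : G ∈ L
    · simpa [hG, Env.conf] using (h G).2 hG
    · simpa [hG, Env.conf] using mt (h G).1 hG
  -- The encoding has length n(n + 1) ≥ n, so a bound in terms of n is one in terms of the length.
  · have := congrArg List.length (map_encodeGraph (ι := ι) G)
    rw [List.length_map, length_rows] at this
    rw [this]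
    nlinarith

end Sweep

/-! ### Graphs without induced paths on four vertices -/

namespace Cograph

/-- The graph `G` has no induced path on four vertices. -/
def P4Free {V : Type*} (G : SimpleGraph V) : Prop :=
  ∀ a b c d, G.Adj a b → G.Adj b c → G.Adj c d → ¬ G.Adj a c → ¬ G.Adj b d → G.Adj a d

/-- The complement of the path abcd is the path bdac. In `P4Free` itself coinciding vertices are
harmless, but here the cases a = c and b = d have to be split off. -/
theorem P4Free.compl {V : Type*} {G : SimpleGraph V} (h : P4Free G) : P4Free Gᶜ := by
  intro a b c d hab hbc hcd hac hbd
  rcases eq_or_ne a c with rfl | hac'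
  · exact hcd
  rcases eq_or_ne b d with rfl | hbd'
  · exact hab
  simp only [SimpleGraph.compl_adj, not_and, not_not] at *
  refine ⟨?_, fun had => hbc.2 (h b d a c (hbd hbd') had.symm (hac hac')
    (fun h => hab.2 h.symm) fun h => hcd.2 h.symm)⟩
  rintro rfl
  exact hcd.2 (hac hac').symm

theorem P4Free.of_embedding {V W : Type*} {G : SimpleGraph V} {H : SimpleGraph W} (h : P4Free H)
    (f : G ↪g H) : P4Free G := fun a b c d => by
  simpa only [f.map_adj_iff] using h (f a) (f b) (f c) (f d)

/-! ### Clique number, colourings and frozen nonedges. -/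

section om
open Classical in
/-- The maximum size of a clique in the set `s` of vertices. -/
noncomputable def om {V : Type*} (G : SimpleGraph V) (s : Finset V) : ℕ :=
  (s.powerset.filter fun K : Finset V => G.IsClique K).sup Finset.card

variable {V : Type*} {G : SimpleGraph V}

theorem card_le_om {s K : Finset V} (hs : K ⊆ s) (hK : G.IsClique K) : K.card ≤ om G s :=
  Finset.le_sup (f := Finset.card) (by simp [hs, hK])

theorem exists_card_eq_om (G : SimpleGraph V) (s : Finset V) :
    ∃ K ⊆ s, G.IsClique K ∧ K.card = om G s := by
  classical
  obtain ⟨K, hK, h⟩ := Finset.exists_mem_eq_sup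
    (s.powerset.filter fun K : Finset V => G.IsClique K) ⟨∅, by simp⟩ Finset.card
  simp only [Finset.mem_filter, Finset.mem_powerset] at hK
  exact ⟨K, hK.1, hK.2, by rw [← h, om]⟩

theorem om_le_card (s : Finset V) : om G s ≤ s.card := by
  obtain ⟨K, hK, hc, h'⟩ := exists_card_eq_om G s
  exact h' ▸ Finset.card_le_card hK

theorem om_empty : om G ∅ = 0 := Nat.le_zero.1 (om_le_card ∅)

theorem om_eq_zero {s : Finset V} : om G s = 0 ↔ s = ∅ := by
  refine ⟨fun h => ?_, fun h => h ▸ om_empty⟩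
  by_contra hs
  obtain ⟨x, hx⟩ := Finset.nonempty_iff_ne_empty.2 hs
  have := card_le_om (G := G) (s := s) (K := {x}) (by simpa using hx) (by simp)
  simp [h] at this

/-- `S` is a maximal independent subset of `s`. -/
structure IsMis (G : SimpleGraph V) (s S : Finset V) : Prop where
  subset : S ⊆ s
  indep : ∀ x ∈ S, ∀ y ∈ S, ¬ G.Adj x y
  maximal : ∀ x ∈ s, x ∉ S → ∃ y ∈ S, G.Adj x y

theorem exists_isMis {s I : Finset V} (hI : I ⊆ s) (hi : ∀ x ∈ I, ∀ y ∈ I, ¬ G.Adj x y) :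
    ∃ S, I ⊆ S ∧ IsMis G s S := by
  classical
  obtain ⟨S, hIS, hS⟩ := Set.Finite.exists_le_maximal
    (s := {S : Finset V | S ⊆ s ∧ ∀ x ∈ S, ∀ y ∈ S, ¬ G.Adj x y})
    (s.powerset.finite_toSet.subset fun S hS => by simpa using hS.1) ⟨hI, hi⟩
  refine ⟨S, hIS, hS.prop.1, hS.prop.2, fun x hx hxS => ?_⟩
  by_contra! h
  refine hxS (hS.le_of_ge (y := insert x S) ⟨?_, ?_⟩ (Finset.subset_insert _ _)
    (Finset.mem_insert_self _ _))
  · exact Finset.insert_subset hx hS.prop.1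
  · simp only [Finset.mem_insert]
    rintro y (rfl | hy) z (rfl | hz) hyz
    · exact hyz.ne rfl
    · exact h z hz hyz
    · exact h y hy hyz.symm
    · exact hS.prop.2 y hy z hz hyz

/-- A clique meets S at most once, so the clique number drops by at most one. Conversely, given a
maximum clique K outside S, let x in S have the most neighbours in K. If some k in K is not adjacent
to x, it has a neighbour y in S by maximality of S; by choice of x some k' in K is adjacent to x but
not to y, and x, k', k, y is an induced path. So x extends K. -/
theorem P4Free.om_sdiff [DecidableEq V] (h : P4Free G) {s S : Finset V} (hS : IsMis G s S) :
    om G (s \ S) = om G s - 1 := by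
  classical
  rcases s.eq_empty_or_nonempty with rfl | ⟨z, hz⟩
  · simp [om_empty]
  have hne : S.Nonempty := by
    by_cases hzS : z ∈ S
    · exact ⟨z, hzS⟩
    · obtain ⟨y, hy, -⟩ := hS.maximal z hz hzS
      exact ⟨y, hy⟩
  apply le_antisymm
  · obtain ⟨K, hK, hc, h'⟩ := exists_card_eq_om G (s \ S)
    rw [Finset.subset_sdiff] at hK
    obtain ⟨x, hx, hmax⟩ := S.exists_max_image (fun x => (K.filter fun k => G.Adj k x).card) hne
    have hall : ∀ k ∈ K, G.Adj k x := by
      intro k hk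
      by_contra hkx
      obtain ⟨y, hy, hky⟩ := hS.maximal k (hK.1 hk) (Finset.disjoint_left.1 hK.2 hk)
      have : ¬ (K.filter fun k => G.Adj k x) ⊆ K.filter fun k => G.Adj k y := by
        intro hsub
        have := Finset.card_lt_card (Finset.ssubset_iff_of_subset hsub |>.2
          ⟨k, by simp [hk, hky], by simp [hkx]⟩)
        exact absurd (hmax y hy) (by omega)
      rw [Finset.not_subset] at this
      obtain ⟨k', hk', hk'y⟩ := this
      simp only [Finset.mem_filter, not_and] at hk' hk'y
      have hne : k' ≠ k := by rintro rfl; exact hkx hk'.2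
      exact hS.indep x hx y hy (h x k' k y hk'.2.symm (hc hk'.1 hk hne) hky
        (fun h => hkx h.symm) (hk'y hk'.1))
    have hxK : x ∉ K := fun hxK => (hall x hxK).ne rfl
    have := card_le_om (G := G) (s := s) (K := insert x K)
      (Finset.insert_subset (hS.subset hx) hK.1) (by
        rw [Finset.coe_insert]
        exact hc.insert fun b hb _ => (hall b hb).symm)
    rw [Finset.card_insert_of_notMem hxK] at this
    omega
  · obtain ⟨K, hK, hc, h'⟩ := exists_card_eq_om G s
    have h₁ : (K ∩ S).card ≤ 1 := by
      refine Finset.card_le_one.2 fun a ha b hb => ?_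
      rw [Finset.mem_inter] at ha hb
      by_contra hab
      exact hS.indep a ha.2 b hb.2 (hc ha.1 hb.1 hab)
    have h₂ := card_le_om (G := G) (s := s \ S) (K := K \ S) (Finset.sdiff_subset_sdiff hK le_rfl)
      (hc.subset (by simp))
    have := Finset.card_sdiff_add_card_inter K S
    omega

/-- The vertices in `s` can be properly coloured with `om G s` colours. -/
theorem P4Free.exists_coloring (h : P4Free G) (s : Finset V) :
    ∃ f : V → ℕ, (∀ x ∈ s, f x < om G s) ∧ ∀ x ∈ s, ∀ y ∈ s, G.Adj x y → f x ≠ f y := by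
  classical
  induction hk : om G s generalizing s with
  | zero =>
    rw [om_eq_zero] at hk
    exact ⟨fun _ => 0, by simp [hk], by simp [hk]⟩
  | succ k ih =>
    -- A maximal independent set takes the last colour; the rest needs one colour less.
    obtain ⟨S, -, hS⟩ := exists_isMis (G := G) (s := s) (I := ∅) (by simp) (by simp)
    obtain ⟨f, hf, hp⟩ := ih (s \ S) (by rw [h.om_sdiff hS, hk]; rfl)
    simp only [Finset.mem_sdiff] at hf hp
    refine ⟨fun x => if x ∈ S then k else f x, fun x hx => ?_, fun x hx y hy hxy => ?_⟩
    · dsimp only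
      split_ifs with hxS
      · omega
      · have := hf x ⟨hx, hxS⟩
        omega
    · dsimp only
      split_ifs with hxS hyS hyS
      · exact absurd hxy (hS.indep x hxS y hyS)
      · exact (hf y ⟨hy, hyS⟩).ne'
      · exact (hf x ⟨hx, hxS⟩).ne
      · exact hp x ⟨hx, hxS⟩ y ⟨hy, hyS⟩ hxy

theorem colorable_of_lt {n : ℕ} (f : V → ℕ) (hf : ∀ x, f x < n)
    (hp : ∀ x y, G.Adj x y → f x ≠ f y) : G.Colorable n :=
  ⟨SimpleGraph.Coloring.mk (fun x => (⟨f x, hf x⟩ : Fin n)) fun {x y} hxy h =>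
    hp x y hxy (by simpa using h)⟩

theorem chiUnfrozenNonedge_comm {u v : V} :
    ChiUnfrozenNonedge G u v ↔ ChiUnfrozenNonedge G v u := by
  rw [ChiUnfrozenNonedge, ChiUnfrozenNonedge, SimpleGraph.edge_comm]

variable [Fintype V]

theorem P4Free.chromaticNumber_eq (h : P4Free G) :
    G.chromaticNumber = om G Finset.univ := by
  apply le_antisymm
  · obtain ⟨f, hf, hp⟩ := h.exists_coloring Finset.univ
    exact (colorable_of_lt f (by simpa using hf) (by simpa using hp)).chromaticNumber_le
  · obtain ⟨K, -, hc, h'⟩ := exists_card_eq_om G Finset.univ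
    rw [← h']
    exact hc.card_le_chromaticNumber

/-- Make S a colour class of its own. Since it contains u but not v, the colouring stays proper when
uv is added, and the rest has a colour to spare. -/
theorem P4Free.chiUnfrozenNonedge_of_mis [DecidableEq V] (h : P4Free G) {u v : V} {S : Finset V}
    (hu : u ∈ S) (hv : v ∉ S) (hi : ∀ x ∈ S, ∀ y ∈ S, ¬ G.Adj x y)
    (hom : om G (Finset.univ \ S) < om G Finset.univ) : ChiUnfrozenNonedge G u v := by
  apply le_antisymm
  · obtain ⟨f, hf, hp⟩ := h.exists_coloring (Finset.univ \ S)
    simp only [Finset.mem_sdiff, Finset.mem_univ, true_and] at hf hp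
    rw [h.chromaticNumber_eq]
    refine (colorable_of_lt (fun x => if x ∈ S then om G (Finset.univ \ S) else f x)
      (fun x => ?_) fun x y hxy => ?_).chromaticNumber_le
    · split_ifs with hxS
      · exact hom
      · exact (hf x hxS).trans hom
    · split_ifs with hxS hyS hyS
      · rw [SimpleGraph.sup_adj, SimpleGraph.edge_adj] at hxy
        rcases hxy with hxy | ⟨⟨rfl, rfl⟩ | ⟨rfl, rfl⟩, -⟩
        · exact absurd hxy (hi x hxS y hyS)
        · exact absurd hyS hv
        · exact absurd hxS hv
      · exact (hf y hyS).ne'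
      · exact (hf x hxS).ne
      · rw [SimpleGraph.sup_adj, SimpleGraph.edge_adj] at hxy
        rcases hxy with hxy | ⟨⟨rfl, rfl⟩ | ⟨rfl, rfl⟩, -⟩
        · exact hp x hxS y hyS hxy
        · exact absurd hu hxS
        · exact absurd hu hyS
  · exact SimpleGraph.chromaticNumber_mono _ le_sup_left

open Classical in
/-- The common neighbours of `u` and `v`. -/
noncomputable def commonNbrs (G : SimpleGraph V) (u v : V) : Finset V :=
  Finset.univ.filter fun x => G.Adj u x ∧ G.Adj v x

theorem mem_commonNbrs {u v x : V} : x ∈ commonNbrs G u v ↔ G.Adj u x ∧ G.Adj v x := by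
  simp [commonNbrs]

theorem om_commonNbrs_lt (G : SimpleGraph V) (u v : V) :
    om G (commonNbrs G u v) + 1 ≤ om G Finset.univ := by
  classical
  obtain ⟨K, hK, hc, h'⟩ := exists_card_eq_om G (commonNbrs G u v)
  have hu : ∀ x ∈ K, G.Adj u x := fun x hx => (mem_commonNbrs.1 (hK hx)).1
  have := card_le_om (G := G) (s := Finset.univ) (K := insert u K) (Finset.subset_univ _) (by
    rw [Finset.coe_insert]
    exact hc.insert fun b hb _ => hu b hb)
  rwa [Finset.card_insert_of_notMem fun h => (hu u h).ne rfl, h'] at this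

/-- A maximal independent set containing u and w avoids v, as v is adjacent to w; it can be the
colour class of u. -/
theorem P4Free.chiUnfrozenNonedge_of_adj (h : P4Free G) {u v w : V} (hvw : G.Adj v w)
    (huw : ¬ G.Adj u w) : ChiUnfrozenNonedge G u v := by
  classical
  obtain ⟨S, hI, hS⟩ := exists_isMis (G := G) (s := Finset.univ) (I := {u, w}) (by simp) (by
    simp [huw, G.adj_comm w u])
  have hu : u ∈ S := hI (by simp)
  have hw : w ∈ S := hI (by simp)
  refine h.chiUnfrozenNonedge_of_mis hu (fun hv => hS.indep v hv w hw hvw) hS.indep ?_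
  rw [h.om_sdiff hS]
  have : om G Finset.univ ≠ 0 := fun h0 => by
    rw [om_eq_zero] at h0
    simpa [h0] using Finset.mem_univ u
  omega

/-- A nonedge `uv` is `χ`-frozen if and only if the common neighbours of `u` and `v` contain
a clique that is smaller by one than the maximum cliques of the graph. -/
theorem P4Free.chiUnfrozenNonedge_iff (h : P4Free G) {u v : V} (huv : u ≠ v)
    (hn : ¬ G.Adj u v) :
    ChiUnfrozenNonedge G u v ↔ om G (commonNbrs G u v) + 1 ≠ om G Finset.univ := by
  classical
  constructor
  · intro hun heq
    obtain ⟨K, hK, hc, h'⟩ := exists_card_eq_om G (commonNbrs G u v)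
    have hu : ∀ x ∈ K, G.Adj u x := fun x hx => (mem_commonNbrs.1 (hK hx)).1
    have hv : ∀ x ∈ K, G.Adj v x := fun x hx => (mem_commonNbrs.1 (hK hx)).2
    -- A maximum clique of the common neighbourhood together with u and v is a clique of G + uv with
    -- ω(G) + 1 vertices.
    have hcl : (G ⊔ SimpleGraph.edge u v).IsClique (insert u (insert v K) : Finset V) := by
      rw [Finset.coe_insert, Finset.coe_insert]
      refine ((hc.mono le_sup_left).insert fun b hb _ => Or.inl (hv b hb)).insert ?_
      rintro b (rfl | hb) hne
      · exact Or.inr (by simp [SimpleGraph.edge_adj, hne])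
      · exact Or.inl (hu b hb)
    have := hcl.card_le_chromaticNumber
    rw [hun, h.chromaticNumber_eq, Finset.card_insert_of_notMem (by
      simpa [huv] using fun h => (hu u h).ne rfl), Finset.card_insert_of_notMem
      fun h => (hv v h).ne rfl, h', heq] at this
    norm_cast at this
    omega
  · intro hne
    by_cases h₁ : ∃ w, G.Adj v w ∧ ¬ G.Adj u w
    · obtain ⟨w, hvw, huw⟩ := h₁
      exact h.chiUnfrozenNonedge_of_adj hvw huw
    by_cases h₂ : ∃ w, G.Adj u w ∧ ¬ G.Adj v w
    · obtain ⟨w, hvw, huw⟩ := h₂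
      exact chiUnfrozenNonedge_comm.1 (h.chiUnfrozenNonedge_of_adj hvw huw)
    push Not at h₁ h₂
    -- Now u and v have the same neighbours. The class S without v works: a clique K avoiding it
    -- either contains v, and then its other vertices are common neighbours, or avoids all of S.
    obtain ⟨S, hI, hS⟩ := exists_isMis (G := G) (s := Finset.univ) (I := {u}) (by simp) (by simp)
    have hu : u ∈ S := hI (by simp)
    refine h.chiUnfrozenNonedge_of_mis (S := S.erase v) (Finset.mem_erase.2 ⟨huv, hu⟩)
      (Finset.notMem_erase v S) (fun x hx y hy => hS.indep x (Finset.mem_of_mem_erase hx) y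
      (Finset.mem_of_mem_erase hy)) ?_
    obtain ⟨K, hK, hc, h'⟩ := exists_card_eq_om G (Finset.univ \ S.erase v)
    have hlt := om_commonNbrs_lt G u v
    rw [← h']
    by_cases hvK : v ∈ K
    · have hsub : K.erase v ⊆ commonNbrs G u v := fun x hx => by
        rw [Finset.mem_erase] at hx
        have := hc hvK hx.2 (Ne.symm hx.1)
        exact mem_commonNbrs.2 ⟨h₁ x this, this⟩
      have := card_le_om hsub (hc.subset (by simp))
      have := Finset.card_erase_add_one hvK
      omega
    · have hsub : K ⊆ Finset.univ \ S := fun x hx => by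
        have := hK hx
        simp only [Finset.mem_sdiff, Finset.mem_univ, true_and, Finset.mem_erase, not_and] at this ⊢
        exact this fun h => hvK (h ▸ hx)
      have := card_le_om hsub hc
      rw [h.om_sdiff hS] at this
      omega

end om

/-! ### Co-graphs are the nonempty graphs without induced paths on four vertices. -/

section cotree

theorem nonempty_vert : (t : CoTree) → Nonempty t.Vert
  | .leaf => ⟨()⟩
  | .union a _ | .join a _ => (nonempty_vert a).map Sum.inl

theorem p4Free_graph (t : CoTree) : P4Free t.graph := by
  induction t with
  | leaf => intro a b c d h; exact h.elim
  | union s t hs ht =>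
    rintro (a | a) (b | b) (c | c) (d | d) <;>
      simp only [CoTree.graph, SimpleGraph.sum_adj_inl, SimpleGraph.sum_adj_inr] <;>
      first | exact hs a b c d | exact ht a b c d | simp [SimpleGraph.sum]
  | join s t hs ht =>
    rintro (a | a) (b | b) (c | c) (d | d) <;>
      first | exact hs a b c d | exact ht a b c d | simp [CoTree.graph, graphJoin]

variable {V : Type*}

/-- The set `s` of vertices has a partition into two nonempty parts that are not joined by any
edge. -/
def Splits (G : SimpleGraph V) (s : Finset V) : Prop :=
  ∃ a ⊆ s, a.Nonempty ∧ (∃ x ∈ s, x ∉ a) ∧ ∀ x ∈ a, ∀ y ∈ s, y ∉ a → ¬ G.Adj x y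

/-- If v is adjacent to all of s, it is isolated in the complement. Otherwise let C be the component
in s of a non-neighbour x of v. If v has no neighbour in C, or none in s outside C, this gives a
splitting. If it has both, an edge wy of C with only y adjacent to v, followed by v and a neighbour
z outside C, is an induced path w, y, v, z. -/
theorem Splits.insert [DecidableEq V] {G : SimpleGraph V} (h : P4Free G) {s : Finset V} {v : V}
    (hv : v ∉ s) (hs : Splits G s) : Splits G (insert v s) ∨ Splits Gᶜ (insert v s) := by
  by_cases hx : ∃ x ∈ s, ¬ G.Adj v x
  swap
  · push Not at hx
    obtain ⟨a, has, ⟨x, hxa⟩, -⟩ := hs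
    refine Or.inr ⟨{v}, by simp, by simp, ⟨x, by simp [has hxa], ?_⟩, ?_⟩
    · rintro hxv
      exact hv (by simpa [Finset.mem_singleton.1 hxv] using has hxa)
    · simp only [Finset.mem_singleton, Finset.mem_insert, SimpleGraph.compl_adj]
      rintro _ rfl y (rfl | hy) hyv h
      · exact hyv rfl
      · exact h.2 (hx y hy)
  left
  obtain ⟨x, hxs, hvx⟩ := hx
  have hcl : ∃ a ⊆ s, x ∈ a ∧ (∃ y ∈ s, y ∉ a) ∧ ∀ x ∈ a, ∀ y ∈ s, y ∉ a → ¬ G.Adj x y := by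
    obtain ⟨a, has, ⟨y, hy⟩, ⟨z, hz, hza⟩, ha⟩ := hs
    by_cases hxa : x ∈ a
    · exact ⟨a, has, hxa, ⟨z, hz, hza⟩, ha⟩
    · refine ⟨s \ a, by simp, by simp [hxs, hxa], ⟨y, has hy, by simp [hy]⟩, ?_⟩
      simp only [Finset.mem_sdiff, not_and, not_not]
      exact fun w hw y hy hya hwy => ha y (hya hy) w hw.1 hw.2 hwy.symm
  -- The component of x, obtained as a minimal proper subset containing x that no edge leaves.
  obtain ⟨C, hC⟩ := Set.Finite.exists_minimal (s := {a : Finset V | a ⊆ s ∧ x ∈ a ∧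
    (∃ y ∈ s, y ∉ a) ∧ ∀ x ∈ a, ∀ y ∈ s, y ∉ a → ¬ G.Adj x y})
    (s.powerset.finite_toSet.subset fun S hS => by simpa using hS.1) hcl
  obtain ⟨hCs, hxC, ⟨w, hws, hwC⟩, hCcl⟩ := hC.prop
  by_cases hvC : ∃ y ∈ C, G.Adj v y
  swap
  · push Not at hvC
    refine ⟨C, hCs.trans (Finset.subset_insert _ _), ⟨x, hxC⟩, ⟨w, by simp [hws], hwC⟩, ?_⟩
    simp only [Finset.mem_insert]
    rintro y hy z (rfl | hz) hzC hyz
    · exact hvC y hy hyz.symm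
    · exact hCcl y hy z hz hzC hyz
  by_cases hvD : ∃ z ∈ s, z ∉ C ∧ G.Adj v z
  swap
  · push Not at hvD
    refine ⟨s \ C, Finset.sdiff_subset.trans (Finset.subset_insert _ _), ⟨w, by simp [hws, hwC]⟩,
      ⟨v, by simp, by simp [hv]⟩, ?_⟩
    simp only [Finset.mem_insert, Finset.mem_sdiff, not_and, not_not]
    rintro y ⟨hy, hyC⟩ z (rfl | hz) hzC hyz
    · exact hvD y hy hyC hyz.symm
    · exact hCcl z (hzC hz) y hy hyC hyz.symm
  exfalso
  obtain ⟨z, hzs, hzC, hvz⟩ := hvD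
  obtain ⟨y₀, hy₀, hvy₀⟩ := hvC
  -- Otherwise the non-neighbours of v in C would contradict the minimality of C.
  have : ∃ w ∈ C, ¬ G.Adj v w ∧ ∃ y ∈ C, G.Adj v y ∧ G.Adj w y := by
    classical
    by_contra! hno
    have := hC.le_of_le (y := C.filter fun w => ¬ G.Adj v w) ⟨?_, ?_, ?_, ?_⟩
      (Finset.filter_subset _ _) hy₀
    · simp [hvy₀] at this
    · exact (Finset.filter_subset _ _).trans hCs
    · simp [hxC, hvx]
    · exact ⟨w, hws, by simp [hwC]⟩
    · simp only [Finset.mem_filter, not_and, not_not]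
      rintro a ⟨haC, hva⟩ b hb hbC hab
      by_cases hbC' : b ∈ C
      · exact hno a haC hva b hbC' (hbC hbC') hab
      · exact hCcl a haC b hb hbC' hab
  obtain ⟨w, hwC', hvw, y, hyC, hvy, hwy⟩ := this
  exact hCcl w hwC' z hzs hzC (h w y v z hwy hvy.symm hvz (fun h => hvw h.symm)
    (hCcl y hyC z hzs hzC))

/-- Vertices are added one at a time; since the hypothesis passes to the complement, `Splits.insert`
applies whichever of the two graphs splits. -/
theorem P4Free.splits {G : SimpleGraph V} (h : P4Free G) (s : Finset V) (hs : 2 ≤ s.card) :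
    Splits G s ∨ Splits Gᶜ s := by
  classical
  induction s using Finset.induction with
  | empty => simp at hs
  | insert v s hv ih =>
    rw [Finset.card_insert_of_notMem hv] at hs
    by_cases h2 : 2 ≤ s.card
    · rcases ih h2 with hsp | hsp
      · exact hsp.insert h hv
      · have := hsp.insert h.compl hv
        rw [compl_compl] at this
        exact this.symm
    · obtain ⟨x, rfl⟩ := Finset.card_eq_one.1 (show s.card = 1 by omega)
      have hvx : v ≠ x := by simpa using hv
      have : ∀ H : SimpleGraph V, ¬ H.Adj v x → Splits H (Insert.insert v {x}) := fun H hH =>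
        ⟨{v}, by simp, by simp, ⟨x, by simp, by simpa using hvx.symm⟩, by simpa using fun _ => hH⟩
      by_cases hadj : G.Adj v x
      · exact Or.inr (this _ (by simp [hadj]))
      · exact Or.inl (this _ hadj)

theorem exists_union {G : SimpleGraph V} {t t' : CoTree} (f : t.graph ↪g G) (f' : t'.graph ↪g G)
    (h : ∀ x y, f x ≠ f' y ∧ ¬ G.Adj (f x) (f' y)) :
    ∃ g : (CoTree.union t t').graph ↪g G, Set.range g = Set.range f ∪ Set.range f' := by
  refine ⟨⟨⟨Sum.elim f f', f.injective.sumElim f'.injective fun x y => (h x y).1⟩, ?_⟩,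
    Set.Sum.elim_range f f'⟩
  rintro (x | x) (y | y)
  · exact f.map_adj_iff
  · exact iff_of_false (h x y).2 (SimpleGraph.not_adj_sum_inl_inr x y)
  · exact iff_of_false (fun hxy => (h y x).2 hxy.symm)
      fun hxy => SimpleGraph.not_adj_sum_inl_inr y x hxy.symm
  · exact f'.map_adj_iff

theorem exists_join {G : SimpleGraph V} {t t' : CoTree} (f : t.graph ↪g G) (f' : t'.graph ↪g G)
    (h : ∀ x y, G.Adj (f x) (f' y)) :
    ∃ g : (CoTree.join t t').graph ↪g G, Set.range g = Set.range f ∪ Set.range f' := by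
  refine ⟨⟨⟨Sum.elim f f', f.injective.sumElim f'.injective fun x y => (h x y).ne⟩, ?_⟩,
    Set.Sum.elim_range f f'⟩
  rintro (x | x) (y | y)
  · exact f.map_adj_iff
  · exact iff_of_true (h x y) trivial
  · exact iff_of_true (h y x).symm trivial
  · exact f'.map_adj_iff

/-- Every nonempty set of vertices of a graph without induced paths on four vertices
is represented by a co-tree. -/
theorem P4Free.exists_coTree {G : SimpleGraph V} (h : P4Free G) (s : Finset V)
    (hs : s.Nonempty) : ∃ (t : CoTree) (f : t.graph ↪g G), Set.range f = s := by
  classical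
  induction s using Finset.strongInduction with
  | H s ih =>
    by_cases h2 : 2 ≤ s.card
    · have key : ∀ a ⊆ s, a.Nonempty → (∃ x ∈ s, x ∉ a) →
          ∃ (t t' : CoTree) (f : t.graph ↪g G) (f' : t'.graph ↪g G),
            (∀ x, f x ∈ a) ∧ (∀ x, f' x ∈ s ∧ f' x ∉ a) ∧ Set.range f ∪ Set.range f' = s := by
        rintro a has ha ⟨x, hx, hxa⟩
        obtain ⟨t, f, hf⟩ := ih a ((Finset.ssubset_iff_of_subset has).2 ⟨x, hx, hxa⟩) ha
        obtain ⟨t', f', hf'⟩ := ih (s \ a) (Finset.sdiff_ssubset has ha) ⟨x, by simp [hx, hxa]⟩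
        refine ⟨t, t', f, f', fun x => ?_, fun x => ?_, ?_⟩
        · rw [← Finset.mem_coe, ← hf]
          exact Set.mem_range_self x
        · rw [← Finset.mem_sdiff, ← Finset.mem_coe, ← hf']
          exact Set.mem_range_self x
        · rw [hf, hf', ← Finset.coe_union, Finset.union_sdiff_of_subset has]
      rcases h.splits s h2 with ⟨a, has, hne, hne', hcl⟩ | ⟨a, has, hne, hne', hcl⟩
      · obtain ⟨t, t', f, f', hf, hf', hr⟩ := key a has hne hne'
        obtain ⟨g, hg⟩ := exists_union f f' fun x y =>
          ⟨fun h => (hf' y).2 (h ▸ hf x), hcl _ (hf x) _ (hf' y).1 (hf' y).2⟩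
        exact ⟨_, g, hg.trans hr⟩
      · obtain ⟨t, t', f, f', hf, hf', hr⟩ := key a has hne hne'
        obtain ⟨g, hg⟩ := exists_join f f' fun x y => by
          have := hcl _ (hf x) _ (hf' y).1 (hf' y).2
          rw [SimpleGraph.compl_adj, not_and, not_not] at this
          exact this fun h => (hf' y).2 (h ▸ hf x)
        exact ⟨_, g, hg.trans hr⟩
    · obtain ⟨x, rfl⟩ := Finset.card_eq_one.1 (show s.card = 1 by have := hs.card_pos; omega)
      refine ⟨.leaf, ⟨⟨fun _ => x, fun _ _ _ => rfl⟩, ?_⟩, ?_⟩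
      · exact iff_of_false (G.loopless.irrefl x) id
      · rw [Finset.coe_singleton]
        exact Set.range_const (ι := Unit)

/-- A finite graph is a co-graph if and only if it is nonempty and has no induced path on
four vertices. -/
theorem isCograph_iff {V : Type*} [Fintype V] {G : SimpleGraph V} :
    IsCograph G ↔ Nonempty V ∧ P4Free G := by
  constructor
  · rintro ⟨t, ⟨φ⟩⟩
    exact ⟨(nonempty_vert t).map φ, (p4Free_graph t).of_embedding φ.symm.toEmbedding⟩
  · rintro ⟨hne, h⟩
    obtain ⟨t, f, hf⟩ := h.exists_coTree Finset.univ Finset.univ_nonempty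
    rw [Finset.coe_univ, Set.range_eq_univ] at hf
    exact ⟨t, ⟨RelIso.ofSurjective f hf⟩⟩

end cotree

end Cograph

/-! ### A graph program that decides whether a graph is an unfrozen co-graph -/

namespace Cograph

open Sweep

/-- The vertex sets of the program: pointers `u`, `v`, `q`, `w` to the current vertices of loops,
the neighbourhoods `nu`, `nv` of `u` and `v`, the sets `all` and `com` of remaining vertices of the
graph and of the common neighbourhood, and an independent set `ind`. -/
inductive Var : Type
  | u | v | q | w | nu | nv | all | com | ind
  deriving DecidableEq

instance : Fintype Var where
  elems := {.u, .v, .q, .w, .nu, .nv, .all, .com, .ind}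
  complete j := by cases j <;> simp

/-- If `q` points to a neighbour of the set `r`, add it to the set `t`. -/
def nbrStep (r t : Var) : Op Var :=
  (Op.test fun a x y => a && x r && y .q).seq <|
    Op.apply fun f x => Function.update x t (x t || (f && x .q))

/-- Let the set `t` be the neighbourhood of the set `r`. -/
def nbr (r t : Var) : Op Var :=
  (Op.apply fun _ x => Function.update x t false).seq <|
    Op.forEach .q (nbrStep r t)

/-- If `q` points to an element of the set `t` without neighbours in `ind`, add it to `ind`. -/
def misStep (t : Var) : Op Var :=
  (Op.test fun a x y => a && x .q && y .ind).seq <|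
    Op.apply fun f x => Function.update x .ind (x .ind || (x .q && x t && !f))

/-- Remove a maximal independent subset from the set `t`. -/
def removeMis (t : Var) : Op Var :=
  (Op.apply fun _ x => Function.update x .ind false).seq <|
    (Op.forEach .q (misStep t)).seq <| Op.apply fun _ x => Function.update x t (x t && !x .ind)

/-- Remove maximal independent sets from `all` and from `com`, unless `com` is empty. -/
def round : Op Var :=
  (Op.test fun _ x _ => x .com).seq <|
    ((removeMis .all).seq (removeMis .com)).ite (Op.setOk fun _ o => o)

/-- Check that the nonedge `uv` is not frozen. -/
def checkNonedge : Op Var :=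
  (Op.apply fun _ x => Function.update (Function.update x .all true) .com (x .nu && x .nv)).seq <|
    -- The single removal accounts for the + 1 in the criterion. Then both sets lose one from their
    -- clique numbers until `com` is empty, so `all` ends up empty iff uv is frozen.
    (removeMis .all).seq <| (Op.forEach .w round).seq <|
      (Op.test fun _ x _ => x .all).seq <| Op.setOk fun f o => o && f

/-- Check that the edge `uv` is not the middle edge of an induced path on four vertices. -/
def checkEdge : Op Var :=
  (Op.test fun a x y => x .nu && !x .nv && !x .v && y .nv && !y .nu && !y .u && !a).seq <|
    Op.setOk fun f o => o && !f

/-- Check the pair `uv`. -/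
def checkPair : Op Var :=
  (nbr .u .nu).seq <| (nbr .v .nv).seq <| (Op.test fun a x y => a && x .u && y .v).seq <|
    checkEdge.ite <| (Op.test fun _ x _ => x .u && !x .v).seq <|
      checkNonedge.ite <| Op.setOk fun _ o => o

/-- Check that the graph is a `χ`-unfrozen co-graph. -/
def check : Op Var :=
  -- This test succeeds iff there is a vertex, so the empty graph is rejected.
  (Op.test fun _ _ _ => true).seq <| (Op.setOk fun f _ => f).seq <|
    Op.forEach .u <| Op.forEach .v checkPair

/-! ### Sets that the operations leave alone, in particular loop pointers. -/

section preserves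
variable {r : Var} {F H : Op Var}

theorem preserves_test (P) : (Op.test P).Preserves r := fun _ _ _ _ => rfl

theorem preserves_setOk (h) : (Op.setOk h).Preserves r := fun _ _ _ _ => rfl

theorem preserves_apply {g} (h : ∀ b x, g b x r = x r) : (Op.apply g).Preserves r :=
  fun _ _ _ _ => h _ _

theorem preserves_seq (hF : F.Preserves r) (hH : H.Preserves r) : (F.seq H).Preserves r :=
  fun n A e x => (hH n A (F n A e) x).trans (hF n A e x)

theorem preserves_ite (hF : F.Preserves r) (hH : H.Preserves r) : (F.ite H).Preserves r := by
  intro n A e x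
  unfold Op.ite
  split_ifs
  · exact hF n A e x
  · exact hH n A e x

theorem preserves_forEach {s : Var} (hF : F.Preserves r) (hs : r ≠ s) :
    (Op.forEach s F).Preserves r := by
  intro n A e x
  simp only [Op.forEach, Env.leave, Function.update_of_ne hs]
  induction List.range n generalizing e with
  | nil => rfl
  | cons i l ih =>
    rw [List.foldl_cons, ih, hF n A]
    simp [Env.enter, hs]

theorem preserves_nbr {s t : Var} (h : r ≠ t) (hq : r ≠ .q) : (nbr s t).Preserves r :=
  preserves_seq (preserves_apply (by simp [h])) <|
    preserves_forEach (preserves_seq (preserves_test _) (preserves_apply (by simp [h]))) hq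

theorem preserves_removeMis {t : Var} (h : r ≠ t) (hq : r ≠ .q) (hi : r ≠ .ind) :
    (removeMis t).Preserves r :=
  preserves_seq (preserves_apply (by simp [hi])) <| preserves_seq
    (preserves_forEach (preserves_seq (preserves_test _) (preserves_apply (by simp [hi]))) hq)
    (preserves_apply (by simp [h]))

theorem preserves_round (ha : r ≠ .all) (hc : r ≠ .com) (hq : r ≠ .q) (hi : r ≠ .ind) :
    round.Preserves r :=
  preserves_seq (preserves_test _) <| preserves_ite (preserves_seq (preserves_removeMis ha hq hi)
    (preserves_removeMis hc hq hi)) (preserves_setOk _)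

theorem preserves_checkPair (hr : r = .u ∨ r = .v) : checkPair.Preserves r := by
  obtain ⟨h₁, h₂, h₃, h₄, h₅, h₆, h₇⟩ : r ≠ .nu ∧ r ≠ .nv ∧ r ≠ .q ∧ r ≠ .w ∧ r ≠ .all ∧
      r ≠ .com ∧ r ≠ .ind := by
    rcases hr with rfl | rfl <;> decide
  refine preserves_seq (preserves_nbr h₁ h₃) <| preserves_seq (preserves_nbr h₂ h₃) <|
    preserves_seq (preserves_test _) <| preserves_ite
      (preserves_seq (preserves_test _) (preserves_setOk _)) <|
    preserves_seq (preserves_test _) <| preserves_ite ?_ (preserves_setOk _)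
  exact preserves_seq (preserves_apply (by simp [h₅, h₆])) <|
    preserves_seq (preserves_removeMis h₅ h₃ h₇) <|
    preserves_seq (preserves_forEach (preserves_round h₅ h₆ h₃ h₇) h₄) <|
    preserves_seq (preserves_test _) (preserves_setOk _)

end preserves

/-! ### The program runs in polynomial time. -/

section feasible

theorem feasible_nbr {s t : Var} (ht : t ≠ .q) : Feasible (nbr s t) :=
  (Feasible.apply _).seq <| ((Feasible.test _).seq (Feasible.apply _)).forEach .q <|
    preserves_seq (preserves_test _) (preserves_apply (by simp [ht.symm]))

theorem feasible_removeMis {t : Var} : Feasible (removeMis t) :=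
  (Feasible.apply _).seq <| (((Feasible.test _).seq (Feasible.apply _)).forEach .q <|
    preserves_seq (preserves_test _) (preserves_apply (by simp))).seq (Feasible.apply _)

theorem feasible_round : Feasible round :=
  (Feasible.test _).seq <| (feasible_removeMis.seq feasible_removeMis).ite (Feasible.setOk _)

theorem feasible_checkPair : Feasible checkPair := by
  refine (feasible_nbr (by decide)).seq <| (feasible_nbr (by decide)).seq <|
    (Feasible.test _).seq <| ((Feasible.test _).seq (Feasible.setOk _)).ite <|
    (Feasible.test _).seq <| Feasible.ite ?_ (Feasible.setOk _)
  exact (Feasible.apply _).seq <| feasible_removeMis.seq <| (feasible_round.forEach .w <|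
    preserves_round (by decide) (by decide) (by decide) (by decide)).seq <|
    (Feasible.test _).seq (Feasible.setOk _)

theorem feasible_check : Feasible check := by
  have h₁ := feasible_checkPair.forEach .v (preserves_checkPair (Or.inr rfl))
  have h₂ : (Op.forEach .v checkPair).Preserves .u :=
    preserves_forEach (preserves_checkPair (Or.inl rfl)) (by decide)
  unfold check
  exact (Feasible.test _).seq ((Feasible.setOk _).seq (h₁.forEach .u h₂))

end feasible

/-! ### Correctness of the program. -/

section spec
variable {n : ℕ} {G : SimpleGraph (Fin n)}

/-- The set of vertices with the mark `j`. -/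
def vset (n : ℕ) (e : Env Var) (j : Var) : Finset (Fin n) :=
  Finset.univ.filter fun x => e.marks x j = true

theorem mem_vset {e : Env Var} {j : Var} {x : Fin n} :
    x ∈ vset n e j ↔ e.marks x j = true := by
  simp [vset]

theorem vset_congr {e e' : Env Var} {j : Var} (h : ∀ x, e'.marks x j = e.marks x j) :
    vset n e' j = vset n e j := by
  simp [vset, h]

theorem test_flag {P : Bool → (Var → Bool) → (Var → Bool) → Bool} {A : ℕ → ℕ → Bool}
    {e : Env Var} : (Op.test P n A e).flag = true ↔
      ∃ a b : Fin n, P (A a b) (e.marks a) (e.marks b) = true := by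
  simp only [Op.test, List.any_eq_true, List.mem_range, Fin.exists_iff]
  exact ⟨fun ⟨a, ha, b, hb, h⟩ => ⟨a, ha, b, hb, h⟩, fun ⟨a, ha, b, hb, h⟩ => ⟨a, ha, b, hb, h⟩⟩

/-- The invariant rule for loops; all specifications of loops below rest on it. -/
theorem forEach_induction {s : Var} {F : Op Var} {A : ℕ → ℕ → Bool} {e : Env Var}
    (P : ℕ → Env Var → Prop) (h₀ : P 0 e)
    (h : ∀ i < n, ∀ e, P i e → P (i + 1) (F n A (e.enter s i))) :
    ∃ e', P n e' ∧ Op.forEach s F n A e = e'.leave s := by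
  refine ⟨_, ?_, rfl⟩
  have : ∀ m ≤ n, P m ((List.range m).foldl (fun e i => F n A (e.enter s i)) e) := by
    intro m hm
    induction m with
    | zero => exact h₀
    | succ m ih =>
      rw [List.range_succ, List.foldl_append]
      exact h m hm _ (ih (by omega))
  exact this n le_rfl

theorem mem_vset_nbr {A : ℕ → ℕ → Bool} {e : Env Var} {r t : Var} (hrt : r ≠ t) (hr : r ≠ .q)
    (ht : t ≠ .q) {x : Fin n} :
    x ∈ vset n (nbr r t n A e) t ↔ ∃ a ∈ vset n e r, A a x = true := by
  obtain ⟨e', ⟨-, h⟩, he'⟩ := forEach_induction (n := n) (s := .q) (F := nbrStep r t) (A := A)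
    (e := (Op.apply fun _ x => Function.update x t false) n A e)
    (fun m e' => (∀ x, e'.marks x r = e.marks x r) ∧
      ∀ x : Fin n, e'.marks x t = true ↔ x < m ∧ ∃ a ∈ vset n e r, A a x = true)
    (by simp [Op.apply, hrt]) fun m hm e₁ ⟨h₁, h₂⟩ => by
      simp only [nbrStep, Op.seq, Op.apply]
      constructor
      · intro x
        simp [Op.test, Env.enter, hr, hrt, h₁]
      · intro x
        rw [Function.update_self, Bool.or_eq_true, Bool.and_eq_true, test_flag]
        simp only [Op.test, Env.enter, Function.update_self, Function.update_of_ne hr,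
          Function.update_of_ne ht, h₁, h₂, mem_vset, Bool.and_eq_true, beq_iff_eq]
        constructor
        · rintro (⟨hx, h⟩ | ⟨⟨a, b, ⟨hab, ha⟩, hb⟩, hx⟩)
          · exact ⟨by omega, h⟩
          · obtain rfl : b = x := Fin.ext (hb.trans hx.symm)
            exact ⟨by omega, a, ha, hab⟩
        · rintro ⟨hx, a, ha, hax⟩
          rcases Nat.lt_succ_iff_lt_or_eq.1 hx with hx | hx
          · exact Or.inl ⟨hx, a, ha, hax⟩
          · exact Or.inr ⟨⟨a, x, ⟨hax, ha⟩, hx⟩, hx⟩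
  rw [mem_vset, nbr, Op.seq, he']
  simpa [Env.leave, ht] using h x

/-- Greedy choice. Invariant after m passes: `ind` is an independent set of vertices of `t` below m,
and each other vertex of `t` below m has a neighbour in it. -/
theorem removeMis_spec {t : Var} (htq : t ≠ .q) (hti : t ≠ .ind) (e : Env Var) :
    ∃ S, IsMis G (vset n e t) S ∧
      vset n (removeMis t n (adjOf ⟨n, G⟩) e) t = vset n e t \ S := by
  obtain ⟨e', ⟨h₁, h₂, h₃, h₄⟩, he'⟩ := forEach_induction (n := n) (s := .q) (F := misStep t)
    (A := adjOf ⟨n, G⟩)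
    (e := (Op.apply fun _ x => Function.update x .ind false) n (adjOf ⟨n, G⟩) e)
    (fun m e' => (∀ x, e'.marks x t = e.marks x t) ∧
        (∀ x : Fin n, e'.marks x .ind = true → x < m ∧ e.marks x t = true) ∧
        (∀ x y : Fin n, e'.marks x .ind = true → e'.marks y .ind = true → ¬ G.Adj x y) ∧
        ∀ x : Fin n, x < m → e.marks x t = true → ¬ e'.marks x .ind = true →
          ∃ y : Fin n, e'.marks y .ind = true ∧ G.Adj x y)
    (by simp [Op.apply, hti]) fun m hm e₁ ⟨h₁, h₂, h₃, h₄⟩ => by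
      have hadj : ∀ x y : Fin n, adjOf ⟨n, G⟩ x y = true ↔ G.Adj x y := fun x y => adjOf_eq_true
      set T := Op.test (fun a x y => a && x .q && y .ind) n (adjOf ⟨n, G⟩) (e₁.enter .q m) with hT
      have hflag : T.flag = true ↔ ∃ y : Fin n, e₁.marks y .ind = true ∧ G.Adj ⟨m, hm⟩ y := by
        rw [hT, test_flag]
        simp only [Env.enter, Function.update_self, Bool.and_eq_true, beq_iff_eq, hadj, ne_eq,
          reduceCtorEq, not_false_eq_true, Function.update_of_ne]
        constructor
        · rintro ⟨a, b, ⟨hab, rfl⟩, hb⟩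
          exact ⟨b, hb, hab⟩
        · rintro ⟨b, hb, hab⟩
          exact ⟨⟨m, hm⟩, b, ⟨hab, rfl⟩, hb⟩
      have hind : ∀ x : Fin n, (misStep t n (adjOf ⟨n, G⟩) (e₁.enter .q m)).marks x .ind = true ↔
          e₁.marks x .ind = true ∨ x = ⟨m, hm⟩ ∧ e.marks x t = true ∧
            ¬ ∃ y : Fin n, e₁.marks y .ind = true ∧ G.Adj ⟨m, hm⟩ y := by
        intro x
        have hTi : T.marks x .ind = e₁.marks x .ind := by simp [hT, Op.test, Env.enter]
        have hTq : T.marks x .q = ((x : ℕ) == m) := by simp [hT, Op.test, Env.enter]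
        have hTt : T.marks x t = e.marks x t := by simp [hT, Op.test, Env.enter, htq, h₁]
        rw [← hflag, misStep, Op.seq, ← hT, Op.apply]
        dsimp only
        rw [Function.update_self, hTi, hTq, hTt]
        simp [Fin.ext_iff, and_assoc]
      refine ⟨fun x => by simp [misStep, Op.seq, Op.apply, Op.test, Env.enter, htq, hti, h₁],
        fun x hx => ?_, fun x y hx hy hxy => ?_, fun x hx hxt hx' => ?_⟩
      · rcases (hind x).1 hx with hx | ⟨rfl, hx, -⟩
        · exact ⟨(h₂ x hx).1.trans (Nat.lt_succ_self m), (h₂ x hx).2⟩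
        · exact ⟨Nat.lt_succ_self m, hx⟩
      · rcases (hind x).1 hx with hx | ⟨rfl, -, hx⟩ <;> rcases (hind y).1 hy with hy | ⟨rfl, -, hy⟩
        · exact h₃ x y hx hy hxy
        · exact hy ⟨x, hx, hxy.symm⟩
        · exact hx ⟨y, hy, hxy⟩
        · exact hxy.ne rfl
      · rw [hind] at hx'
        push Not at hx'
        rcases Nat.lt_succ_iff_lt_or_eq.1 hx with hx | hx
        · obtain ⟨y, hy, hxy⟩ := h₄ x hx hxt hx'.1
          exact ⟨y, (hind y).2 (Or.inl hy), hxy⟩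
        · obtain rfl : x = ⟨m, hm⟩ := Fin.ext hx
          obtain ⟨y, hy, hxy⟩ := hx'.2 rfl hxt
          exact ⟨y, (hind y).2 (Or.inl hy), hxy⟩
  refine ⟨vset n e' .ind, ⟨fun x hx => ?_, fun x hx y hy => ?_, fun x hx hx' => ?_⟩, ?_⟩
  · exact mem_vset.2 (h₂ x (mem_vset.1 hx)).2
  · exact h₃ x y (mem_vset.1 hx) (mem_vset.1 hy)
  · obtain ⟨y, hy⟩ := h₄ x x.2 (mem_vset.1 hx) (mt mem_vset.2 hx')
    exact ⟨y, mem_vset.2 hy.1, hy.2⟩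
  · ext x
    rw [Finset.mem_sdiff, mem_vset, mem_vset, mem_vset, removeMis, Op.seq, Op.seq, he']
    simp [Op.apply, Env.leave, htq, h₁]

theorem ok_forEach {s : Var} {F : Op Var} {A : ℕ → ℕ → Bool} (h : ∀ e, (F n A e).ok = e.ok)
    (e : Env Var) : (Op.forEach s F n A e).ok = e.ok := by
  obtain ⟨e', h', he'⟩ := forEach_induction (n := n) (s := s) (F := F) (A := A) (e := e)
    (fun _ e' => e'.ok = e.ok) rfl fun i _ e' h' => (h _).trans h'
  rw [he', ← h']
  rfl

theorem ok_removeMis (t : Var) (A : ℕ → ℕ → Bool) (e : Env Var) :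
    (removeMis t n A e).ok = e.ok :=
  ok_forEach (fun _ => rfl) _

theorem ok_round (A : ℕ → ℕ → Bool) (e : Env Var) : (round n A e).ok = e.ok := by
  simp only [round, Op.seq, Op.ite]
  split_ifs
  · rw [ok_removeMis, ok_removeMis]
    rfl
  · rfl

theorem om_removeMis (h : P4Free G) {t : Var} (htq : t ≠ .q) (hti : t ≠ .ind) (e : Env Var) :
    om G (vset n (removeMis t n (adjOf ⟨n, G⟩) e) t) = om G (vset n e t) - 1 := by
  obtain ⟨S, hS, h'⟩ := removeMis_spec (G := G) htq hti e
  rw [h', h.om_sdiff hS]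

/-- The `min 1` says that `all` shrinks only while `com` is nonempty. -/
theorem om_round (h : P4Free G) (e : Env Var) :
    om G (vset n (round n (adjOf ⟨n, G⟩) e) .com) = om G (vset n e .com) - 1 ∧
      om G (vset n (round n (adjOf ⟨n, G⟩) e) .all) =
        om G (vset n e .all) - min 1 (om G (vset n e .com)) := by
  have hf : (Op.test (fun _ x _ => x .com) n (adjOf ⟨n, G⟩) e).flag = true ↔
      om G (vset n e .com) ≠ 0 := by
    rw [test_flag, ne_eq, om_eq_zero, ← ne_eq, ← Finset.nonempty_iff_ne_empty]
    exact ⟨fun ⟨a, _, ha⟩ => ⟨a, mem_vset.2 ha⟩, fun ⟨a, ha⟩ => ⟨a, a, mem_vset.1 ha⟩⟩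
  have hv : ∀ j, vset n (Op.test (fun _ x _ => x .com) n (adjOf ⟨n, G⟩) e) j = vset n e j :=
    fun _ => rfl
  simp only [round, Op.seq, Op.ite, hf]
  split_ifs with h0
  · constructor
    · rw [om_removeMis h (by decide) (by decide), vset_congr (preserves_removeMis (r := .com)
        (by decide) (by decide) (by decide) n _ _), hv]
    · rw [vset_congr (preserves_removeMis (r := .all) (by decide) (by decide) (by decide) n _ _),
        om_removeMis h (by decide) (by decide), hv]
      omega
  · rw [not_not] at h0
    change om G (vset n e .com) = _ ∧ om G (vset n e .all) = _
    omega

/-- On arbitrary graphs the outcome of this check has no meaning, but it can never turn a failure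
into a success. -/
theorem checkNonedge_ok_of (A : ℕ → ℕ → Bool) (e : Env Var) (h : (checkNonedge n A e).ok = true) :
    e.ok = true := by
  simp only [checkNonedge, Op.seq, Op.setOk, Op.test, Bool.and_eq_true] at h
  have := h.1
  rw [ok_forEach (ok_round A), ok_removeMis] at this
  exact this

/-- After m rounds `com` has lost m and `all` has lost 1 + min m ω(com), with ω the initial value.
As ω(com) ≤ n, the n rounds exhaust `com`. -/
theorem checkNonedge_ok (h : P4Free G) {x y : Fin n} (e : Env Var)
    (hx : ∀ z : Fin n, e.marks z .nu = true ↔ G.Adj x z)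
    (hy : ∀ z : Fin n, e.marks z .nv = true ↔ G.Adj y z) :
    (checkNonedge n (adjOf ⟨n, G⟩) e).ok = true ↔
      e.ok = true ∧ om G (commonNbrs G x y) + 1 ≠ om G Finset.univ := by
  set e₁ := (Op.apply fun _ x => Function.update (Function.update x .all true) .com
    (x .nu && x .nv)) n (adjOf ⟨n, G⟩) e with he₁
  have hcom : vset n e₁ .com = commonNbrs G x y := by
    ext z
    simp [mem_vset, mem_commonNbrs, he₁, Op.apply, hx, hy]
  have hall : vset n e₁ .all = Finset.univ := by
    ext z
    simp [mem_vset, he₁, Op.apply]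
  set e₂ := removeMis .all n (adjOf ⟨n, G⟩) e₁ with he₂
  have hcom₂ : vset n e₂ .com = commonNbrs G x y := by
    rw [← hcom]
    exact vset_congr (preserves_removeMis (by decide) (by decide) (by decide) n _ _)
  have hall₂ : om G (vset n e₂ .all) = om G Finset.univ - 1 := by
    rw [he₂, om_removeMis h (by decide) (by decide), hall]
  obtain ⟨e₃, ⟨h₁, h₂, h₃⟩, he₃⟩ := forEach_induction (n := n) (s := .w) (F := round)
    (A := adjOf ⟨n, G⟩) (e := e₂) (fun m e' => e'.ok = e₂.ok ∧
      om G (vset n e' .com) = om G (commonNbrs G x y) - m ∧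
      om G (vset n e' .all) = om G Finset.univ - 1 - min m (om G (commonNbrs G x y)))
    ⟨rfl, by rw [hcom₂]; rfl, by rw [hall₂]; simp⟩ fun m hm e' ⟨h₁, h₂, h₃⟩ => by
      obtain ⟨h₄, h₅⟩ := om_round h (e'.enter .w m)
      have hv : ∀ j, j ≠ .w → vset n (e'.enter .w m) j = vset n e' j := fun j hj =>
        vset_congr fun x => by simp [Env.enter, hj]
      rw [hv _ (by decide), h₂] at h₄
      rw [hv _ (by decide), hv _ (by decide), h₂, h₃] at h₅
      refine ⟨(ok_round _ _).trans h₁, by omega, by omega⟩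
  have hle := om_le_card (G := G) (commonNbrs G x y)
  have hle' := Finset.card_le_univ (commonNbrs G x y)
  rw [Fintype.card_fin] at hle'
  have hlt := om_commonNbrs_lt G x y
  have hok₂ : e₂.ok = e.ok := ok_removeMis _ _ _
  simp only [checkNonedge, Op.seq, Op.setOk, Bool.and_eq_true, test_flag]
  rw [← he₁, ← he₂, he₃]
  have hne : (∃ a _ : Fin n, (e₃.leave .w).marks a .all = true) ↔ om G (vset n e₃ .all) ≠ 0 := by
    rw [ne_eq, om_eq_zero, ← ne_eq, ← Finset.nonempty_iff_ne_empty]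
    exact ⟨fun ⟨a, _, ha⟩ => ⟨a, mem_vset.2 ha⟩, fun ⟨a, ha⟩ => ⟨a, a, mem_vset.1 ha⟩⟩
  rw [hne]
  refine and_congr ?_ (by omega)
  rw [← hok₂, ← h₁]
  rfl

/-- The requirement that is checked for the edge `xy`. -/
def NoPath (G : SimpleGraph (Fin n)) (x y : Fin n) : Prop :=
  ∀ a d, G.Adj a x → G.Adj y d → ¬ G.Adj a y → ¬ G.Adj x d → G.Adj a d

theorem checkEdge_ok {x y : Fin n} (e : Env Var)
    (hu : ∀ z : Fin n, e.marks z .u = true ↔ z = x)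
    (hv : ∀ z : Fin n, e.marks z .v = true ↔ z = y)
    (hx : ∀ z : Fin n, e.marks z .nu = true ↔ G.Adj x z)
    (hy : ∀ z : Fin n, e.marks z .nv = true ↔ G.Adj y z) :
    (checkEdge n (adjOf ⟨n, G⟩) e).ok = true ↔ e.ok = true ∧ NoPath G x y := by
  have hadj : ∀ x y : Fin n, adjOf ⟨n, G⟩ x y = true ↔ G.Adj x y := fun x y => adjOf_eq_true
  simp only [checkEdge, Op.seq, Op.setOk, Bool.and_eq_true, Bool.not_eq_true',
    ← Bool.not_eq_true, test_flag, hu, hv, hx, hy, hadj]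
  refine and_congr Iff.rfl ⟨fun h a d ha hd hay hxd => ?_, ?_⟩
  · by_contra had
    -- The program skips a = y and d = x; there `NoPath` holds trivially.
    by_cases hay' : a = y
    · exact had (hay' ▸ hd)
    by_cases hdx : d = x
    · exact had (hdx ▸ ha)
    exact h ⟨a, d, ⟨⟨⟨⟨⟨⟨ha.symm, fun h => hay h.symm⟩, hay'⟩, hd⟩, hxd⟩, hdx⟩, had⟩⟩
  · rintro h ⟨a, d, ⟨⟨⟨⟨⟨⟨ha, hay⟩, -⟩, hd⟩, hxd⟩, -⟩, had⟩⟩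
    exact had (h a d ha.symm hd (fun h => hay h.symm) hxd)

theorem ok_nbr (r t : Var) (A : ℕ → ℕ → Bool) (e : Env Var) : (nbr r t n A e).ok = e.ok :=
  ok_forEach (fun _ => rfl) _

/-- Only the clause on nonedges needs `P4Free`. The others hold for every graph, so that induced
paths can be excluded first. -/
theorem checkPair_ok {x y : Fin n} (e : Env Var)
    (hu : ∀ z, e.marks z .u = (z == x)) (hv : ∀ z, e.marks z .v = (z == y)) :
    (G.Adj x y → ((checkPair n (adjOf ⟨n, G⟩) e).ok = true ↔ e.ok = true ∧ NoPath G x y)) ∧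
    (x = y → (checkPair n (adjOf ⟨n, G⟩) e).ok = e.ok) ∧
    ((checkPair n (adjOf ⟨n, G⟩) e).ok = true → e.ok = true) ∧
    (¬ G.Adj x y → x ≠ y → P4Free G → ((checkPair n (adjOf ⟨n, G⟩) e).ok = true ↔
      e.ok = true ∧ om G (commonNbrs G x y) + 1 ≠ om G Finset.univ)) := by
  have hadj : ∀ x y : Fin n, adjOf ⟨n, G⟩ x y = true ↔ G.Adj x y := fun x y => adjOf_eq_true
  set e₁ := nbr .u .nu n (adjOf ⟨n, G⟩) e with he₁
  set e₂ := nbr .v .nv n (adjOf ⟨n, G⟩) e₁ with he₂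
  have hu₁ : ∀ z, e₁.marks z .u = (z == x) := fun z =>
    (preserves_nbr (by decide) (by decide) n _ _ z).trans (hu z)
  have hv₁ : ∀ z, e₁.marks z .v = (z == y) := fun z =>
    (preserves_nbr (by decide) (by decide) n _ _ z).trans (hv z)
  have hu₂ : ∀ z : Fin n, e₂.marks z .u = true ↔ z = x := fun z => by
    rw [he₂, preserves_nbr (by decide) (by decide) n, hu₁]
    simp [Fin.ext_iff]
  have hv₂ : ∀ z : Fin n, e₂.marks z .v = true ↔ z = y := fun z => by
    rw [he₂, preserves_nbr (by decide) (by decide) n, hv₁]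
    simp [Fin.ext_iff]
  have hx₂ : ∀ z : Fin n, e₂.marks z .nu = true ↔ G.Adj x z := fun z => by
    rw [he₂, preserves_nbr (by decide) (by decide) n, ← mem_vset, he₁,
      mem_vset_nbr (by decide) (by decide) (by decide)]
    simp [mem_vset, hu, hadj, ← Fin.ext_iff]
  have hy₂ : ∀ z : Fin n, e₂.marks z .nv = true ↔ G.Adj y z := fun z => by
    rw [← mem_vset, he₂, mem_vset_nbr (by decide) (by decide) (by decide)]
    simp [mem_vset, hv₁, hadj, ← Fin.ext_iff]
  have hok : e₂.ok = e.ok := (ok_nbr _ _ _ _).trans (ok_nbr _ _ _ _)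
  have hf₁ : (Op.test (fun a x y => a && x .u && y .v) n (adjOf ⟨n, G⟩) e₂).flag = true ↔
      G.Adj x y := by
    rw [test_flag]
    simp [hadj, hu₂, hv₂]
  set e₃ := Op.test (fun a x y => a && x .u && y .v) n (adjOf ⟨n, G⟩) e₂ with he₃
  have hf₂ : (Op.test (fun _ x _ => x .u && !x .v) n (adjOf ⟨n, G⟩) e₃).flag = true ↔ x ≠ y := by
    rw [test_flag]
    simp only [he₃, Op.test, Bool.and_eq_true, Bool.not_eq_true', ← Bool.not_eq_true, hu₂, hv₂]
    exact ⟨fun ⟨a, _, h, h'⟩ => h ▸ h', fun h => ⟨x, x, rfl, h⟩⟩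
  set e₄ := Op.test (fun _ x _ => x .u && !x .v) n (adjOf ⟨n, G⟩) e₃ with he₄
  have h₁ : G.Adj x y → checkPair n (adjOf ⟨n, G⟩) e = checkEdge n (adjOf ⟨n, G⟩) e₃ := by
    intro h
    simp only [checkPair, Op.seq, Op.ite]
    rw [← he₁, ← he₂, ← he₃, if_pos (hf₁.2 h)]
  have h₂ : ¬ G.Adj x y → x ≠ y →
      checkPair n (adjOf ⟨n, G⟩) e = checkNonedge n (adjOf ⟨n, G⟩) e₄ := by
    intro h h'
    simp only [checkPair, Op.seq, Op.ite]
    rw [← he₁, ← he₂, ← he₃, if_neg (mt hf₁.1 h), ← he₄, if_pos (hf₂.2 h')]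
  have h₃ : x = y → checkPair n (adjOf ⟨n, G⟩) e =
      Op.setOk (fun _ o => o) n (adjOf ⟨n, G⟩) e₄ := by
    intro h
    simp only [checkPair, Op.seq, Op.ite]
    rw [← he₁, ← he₂, ← he₃, if_neg (mt hf₁.1 (h ▸ G.loopless.irrefl x)), ← he₄,
      if_neg (mt hf₂.1 (not_not.2 h))]
  have hedge := checkEdge_ok (G := G) e₃ hu₂ hv₂ hx₂ hy₂
  rw [show e₃.ok = e.ok from hok] at hedge
  refine ⟨fun h => by rw [h₁ h, hedge], fun h => by rw [h₃ h]; exact hok, fun h => ?_,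
    fun h h' hP => ?_⟩
  · by_cases hxy : G.Adj x y
    · rw [h₁ hxy, hedge] at h
      exact h.1
    · by_cases hne : x = y
      · rw [h₃ hne] at h
        exact hok ▸ h
      · rw [h₂ hxy hne] at h
        exact hok ▸ (checkNonedge_ok_of _ _ h : e₄.ok = true)
  · rw [h₂ h h', checkNonedge_ok hP (x := x) (y := y) e₄ hx₂ hy₂]
    exact and_congr_left fun _ => by rw [← hok]; rfl

/-- Under `h`, `ok` is never restored, so success at the end means that every pass succeeded. The
invariant `I` carries the pointer of an outer loop. -/
theorem forEach_ok_imp {s : Var} {F : Op Var} {A : ℕ → ℕ → Bool} {e : Env Var}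
    (I : Env Var → Prop) (c : Fin n → Prop) (hI : ∀ (i : Fin n) (e), I e → I (F n A (e.enter s i)))
    (h : ∀ (i : Fin n) (e), I e → (F n A (e.enter s i)).ok = true → e.ok = true ∧ c i) (he : I e)
    (hok : (Op.forEach s F n A e).ok = true) : e.ok = true ∧ ∀ i, c i := by
  obtain ⟨e', ⟨-, h'⟩, he'⟩ := forEach_induction (n := n) (s := s) (F := F) (A := A) (e := e)
    (fun m e' => I e' ∧ (e'.ok = true → e.ok = true ∧ ∀ i : Fin n, i < m → c i))
    ⟨he, fun h => ⟨h, by simp⟩⟩ fun m hm e' ⟨h₁, h₂⟩ => by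
      refine ⟨hI ⟨m, hm⟩ e' h₁, fun h₃ => ?_⟩
      obtain ⟨h₄, h₅⟩ := h ⟨m, hm⟩ e' h₁ h₃
      refine ⟨(h₂ h₄).1, fun i hi => ?_⟩
      rcases Nat.lt_succ_iff_lt_or_eq.1 hi with hi | hi
      · exact (h₂ h₄).2 i hi
      · obtain rfl : i = ⟨m, hm⟩ := Fin.ext hi
        exact h₅
  rw [he'] at hok
  exact ⟨(h' hok).1, fun i => (h' hok).2 i i.2⟩

theorem forEach_ok {s : Var} {F : Op Var} {A : ℕ → ℕ → Bool} {e : Env Var}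
    (I : Env Var → Prop) (hI : ∀ (i : Fin n) (e), I e → I (F n A (e.enter s i)))
    (h : ∀ (i : Fin n) (e), I e → e.ok = true → (F n A (e.enter s i)).ok = true) (he : I e)
    (hok : e.ok = true) : (Op.forEach s F n A e).ok = true := by
  obtain ⟨e', ⟨-, h'⟩, he'⟩ := forEach_induction (n := n) (s := s) (F := F) (A := A) (e := e)
    (fun m e' => I e' ∧ e'.ok = true) ⟨he, hok⟩ fun m hm e' ⟨h₁, h₂⟩ =>
      ⟨hI ⟨m, hm⟩ e' h₁, h ⟨m, hm⟩ e' h₁ h₂⟩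
  rw [he']
  exact h'

theorem checkPair_enter {x : Fin n} (A : ℕ → ℕ → Bool) (y : Fin n) (e : Env Var)
    (he : ∀ z, e.marks z .u = (z == x)) (z : ℕ) :
    (checkPair n A (e.enter .v y)).marks z .u = (z == x) := by
  rw [preserves_checkPair (Or.inl rfl) n]
  simpa [Env.enter] using he z

theorem loops_ok_imp {e : Env Var} (c : Fin n → Fin n → Prop)
    (h : ∀ (x y : Fin n) (e : Env Var), (∀ z : ℕ, e.marks z .u = (z == x)) →
      (∀ z : ℕ, e.marks z .v = (z == y)) →
      (checkPair n (adjOf ⟨n, G⟩) e).ok = true → e.ok = true ∧ c x y)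
    (hok : (Op.forEach .u (Op.forEach .v checkPair) n (adjOf ⟨n, G⟩) e).ok = true) :
    e.ok = true ∧ ∀ x y, c x y := by
  refine forEach_ok_imp (fun _ => True) (fun x => ∀ y, c x y) (fun _ _ _ => trivial)
    (fun x e _ hok => ?_) trivial hok
  refine forEach_ok_imp (e := e.enter .u x) (fun e => ∀ z : ℕ, e.marks z .u = (z == x)) (c x)
    (checkPair_enter _) (fun y e he hok => ?_) ?_ hok
  swap
  · exact fun z => by simp [Env.enter]
  exact h x y (e.enter .v y) (fun z => by simpa [Env.enter] using he z)
    (fun z => by simp [Env.enter]) hok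

theorem loops_ok {e : Env Var}
    (h : ∀ (x y : Fin n) (e : Env Var), (∀ z : ℕ, e.marks z .u = (z == x)) →
      (∀ z : ℕ, e.marks z .v = (z == y)) →
      e.ok = true → (checkPair n (adjOf ⟨n, G⟩) e).ok = true) (hok : e.ok = true) :
    (Op.forEach .u (Op.forEach .v checkPair) n (adjOf ⟨n, G⟩) e).ok = true := by
  refine forEach_ok (fun _ => True) (fun _ _ _ => trivial) (fun x e _ hok => ?_) trivial hok
  refine forEach_ok (n := n) (e := e.enter .u x) (fun e => ∀ z : ℕ, e.marks z .u = (z == x))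
    (checkPair_enter _) (fun y e he hok => ?_) ?_ hok
  swap
  · exact fun z => by simp [Env.enter]
  exact h x y (e.enter .v y) (fun z => by simpa [Env.enter] using he z)
    (fun z => by simp [Env.enter]) hok

theorem check_ok : (check n (adjOf ⟨n, G⟩) Env.init).ok = true ↔ IsCograph G ∧ ChiUnfrozen G := by
  set e₁ : Env Var := Op.setOk (fun f _ => f) n (adjOf ⟨n, G⟩)
    (Op.test (fun _ _ _ => true) n (adjOf ⟨n, G⟩) Env.init) with he₁
  have hok : e₁.ok = true ↔ Nonempty (Fin n) := by
    rw [he₁, Op.setOk, test_flag]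
    exact ⟨fun ⟨a, _⟩ => ⟨a⟩, fun ⟨a⟩ => ⟨a, a, rfl⟩⟩
  rw [isCograph_iff, show check n (adjOf ⟨n, G⟩) Env.init =
    Op.forEach .u (Op.forEach .v checkPair) n (adjOf ⟨n, G⟩) e₁ from rfl, ← hok]
  constructor
  · intro h
    obtain ⟨h₁, h₂⟩ := loops_ok_imp (fun x y => G.Adj x y → NoPath G x y)
      (fun x y e hu hv hok => ⟨(checkPair_ok e hu hv).2.2.1 hok,
        fun hxy => (((checkPair_ok e hu hv).1 hxy).1 hok).2⟩) h
    have hP : P4Free G := fun a b c d hab hbc hcd hac hbd => h₂ b c hbc a d hab hcd hac hbd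
    -- The same run is evaluated again: with `P4Free` known from the edges, the checks of the
    -- nonedges become meaningful.
    obtain ⟨-, h₃⟩ := loops_ok_imp (fun x y => x ≠ y → ¬ G.Adj x y →
        om G (commonNbrs G x y) + 1 ≠ om G Finset.univ)
      (fun x y e hu hv hok => ⟨(checkPair_ok e hu hv).2.2.1 hok,
        fun hne hxy => (((checkPair_ok e hu hv).2.2.2 hxy hne hP).1 hok).2⟩) h
    exact ⟨⟨h₁, hP⟩, fun x y hne hxy => (hP.chiUnfrozenNonedge_iff hne hxy).2 (h₃ x y hne hxy)⟩
  · rintro ⟨⟨h₁, hP⟩, h₂⟩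
    refine loops_ok (fun x y e hu hv hok => ?_) h₁
    have h := checkPair_ok (G := G) e hu hv
    by_cases hxy : G.Adj x y
    · exact (h.1 hxy).2 ⟨hok, fun a d hax hyd hay hxd => hP a x y d hax hxy hyd hay hxd⟩
    · by_cases hne : x = y
      · rw [h.2.1 hne, hok]
      · exact (h.2.2.2 hxy hne hP).2 ⟨hok, (hP.chiUnfrozenNonedge_iff hne hxy).1 (h₂ x y hne hxy)⟩

end spec

/-- The problem of `χ`-unfrozenness is in `P` for co-graphs. -/
theorem graphProblemInP_chiUnfrozen :
    GraphProblemInP {G : FinGraph | IsCograph G.2 ∧ ChiUnfrozen G.2} :=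
  graphProblemInP_of_feasible feasible_check fun _ => check_ok

end Cograph

/-! ### The chromatic classification of the nonedges of a co-tree -/

namespace Cograph

/-! ### Chromatic number of joins. -/

section join
variable {V W : Type*} {G : SimpleGraph V} {H : SimpleGraph W}

theorem colorable_graphJoin {m n : ℕ} (hG : G.Colorable m) (hH : H.Colorable n) :
    (graphJoin G H).Colorable (m + n) := by
  obtain ⟨f⟩ := hG
  obtain ⟨g⟩ := hH
  refine ⟨SimpleGraph.Coloring.mk (Sum.elim (fun x => Fin.castAdd n (f x))
    fun x => Fin.natAdd m (g x)) ?_⟩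
  rintro (x | x) (y | y) h
  · exact fun he => f.valid h (Fin.castAdd_injective m n he)
  · exact fun he => by simpa using congrArg Fin.val he |>.symm.le.trans_lt (f x).2
  · exact fun he => by simpa using congrArg Fin.val he |>.le.trans_lt (f y).2
  · exact fun he => g.valid h (Fin.natAdd_injective n m he)

/-- The two sides of a join use disjoint sets of colours. -/
theorem colorable_of_graphJoin {k : ℕ} (h : (graphJoin G H).Colorable k) :
    ∃ m n, m + n ≤ k ∧ G.Colorable m ∧ H.Colorable n := by
  classical
  obtain ⟨f⟩ := h
  let S : Finset (Fin k) := Finset.univ.filter fun c => ∃ x, f (Sum.inl x) = c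
  have hS : ∀ x, f (Sum.inl x) ∈ S := fun x => by simp [S]
  have hS' : ∀ y, f (Sum.inr y) ∈ Sᶜ := fun y => by
    simp only [S, Finset.mem_compl, Finset.mem_filter, Finset.mem_univ, true_and, not_exists]
    exact fun x => f.valid (v := Sum.inl x) (w := Sum.inr y) trivial
  refine ⟨S.card, Sᶜ.card, by rw [Finset.card_add_card_compl, Fintype.card_fin], ?_, ?_⟩
  · have := (SimpleGraph.Coloring.mk (G := G) (fun x => (⟨_, hS x⟩ : S)) fun {x y} h he =>
      f.valid (v := Sum.inl x) (w := Sum.inl y) h (congrArg Subtype.val he)).colorable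
    rwa [Fintype.card_coe] at this
  · have := (SimpleGraph.Coloring.mk (G := H) (fun x => (⟨_, hS' x⟩ : (Sᶜ : Finset _)))
      fun {x y} h he =>
      f.valid (v := Sum.inr x) (w := Sum.inr y) h (congrArg Subtype.val he)).colorable
    rwa [Fintype.card_coe] at this

theorem chromaticNumber_graphJoin {m n : ℕ} (hG : G.chromaticNumber = m)
    (hH : H.chromaticNumber = n) : (graphJoin G H).chromaticNumber = (m + n : ℕ) := by
  apply le_antisymm
  · exact (colorable_graphJoin (SimpleGraph.chromaticNumber_le_iff_colorable.1 hG.le)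
      (SimpleGraph.chromaticNumber_le_iff_colorable.1 hH.le)).chromaticNumber_le
  · refine le_of_forall_ge fun c hc => ?_
    induction c using ENat.recTopCoe with
    | top => exact le_top
    | coe k =>
      obtain ⟨m', n', hk, hG', hH'⟩ :=
        colorable_of_graphJoin (SimpleGraph.chromaticNumber_le_iff_colorable.1 hc)
      have h₁ := hG'.chromaticNumber_le
      have h₂ := hH'.chromaticNumber_le
      rw [hG] at h₁
      rw [hH] at h₂
      norm_cast at h₁ h₂ ⊢
      omega

end join

/-- The node labels are the chromatic numbers. -/
theorem chromaticNumber_graph (t : CoTree) : t.graph.chromaticNumber = t.chi := by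
  induction t with
  | leaf =>
    have : Nonempty CoTree.leaf.Vert := nonempty_vert _
    exact SimpleGraph.chromaticNumber_bot (V := Unit)
  | union a b ha hb =>
    refine SimpleGraph.chromaticNumber_sum.trans ?_
    rw [ha, hb]
    rfl
  | join a b ha hb => exact chromaticNumber_graphJoin ha hb

theorem one_le_chi (t : CoTree) : 1 ≤ t.chi := by
  induction t with
  | leaf => rfl
  | union a b ha hb => exact ha.trans (le_max_left _ _)
  | join a b ha hb => exact ha.trans (Nat.le_add_right _ _)

theorem natCast_max (m n : ℕ) : ((max m n : ℕ) : ℕ∞) = max (m : ℕ∞) n := by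
  rcases le_total m n with h | h <;> simp [h]

/-! ### Adding an edge to a union or a join. -/

section edges
variable {V W : Type*} {G : SimpleGraph V} {H : SimpleGraph W}

theorem sup_edge_adj {u v x y : V} : (G ⊔ SimpleGraph.edge u v).Adj x y ↔
    G.Adj x y ∨ (x = u ∧ y = v ∨ x = v ∧ y = u) ∧ x ≠ y := by
  rw [SimpleGraph.sup_adj, SimpleGraph.edge_adj]

theorem sum_sup_edge_inl (u v : V) :
    (G ⊕g H) ⊔ SimpleGraph.edge (Sum.inl u) (Sum.inl v) = (G ⊔ SimpleGraph.edge u v) ⊕g H := by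
  ext (x | x) (y | y) <;> simp [SimpleGraph.edge_adj, SimpleGraph.sum]

theorem sum_sup_edge_inr (u v : W) :
    (G ⊕g H) ⊔ SimpleGraph.edge (Sum.inr u) (Sum.inr v) = G ⊕g (H ⊔ SimpleGraph.edge u v) := by
  ext (x | x) (y | y) <;> simp [SimpleGraph.edge_adj, SimpleGraph.sum]

theorem join_sup_edge_inl (u v : V) :
    graphJoin G H ⊔ SimpleGraph.edge (Sum.inl u) (Sum.inl v) =
      graphJoin (G ⊔ SimpleGraph.edge u v) H := by
  ext (x | x) (y | y) <;> simp [SimpleGraph.edge_adj, graphJoin]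

theorem join_sup_edge_inr (u v : W) :
    graphJoin G H ⊔ SimpleGraph.edge (Sum.inr u) (Sum.inr v) =
      graphJoin G (H ⊔ SimpleGraph.edge u v) := by
  ext (x | x) (y | y) <;> simp [SimpleGraph.edge_adj, graphJoin]

/-- An edge between the parts of a disjoint union does not change the chromatic number, unless
both parts have chromatic number `1`. -/
theorem chromaticNumber_sum_sup_edge {m n : ℕ} (hG : G.chromaticNumber = m)
    (hH : H.chromaticNumber = n) (hm : 1 ≤ m) (hn : 1 ≤ n) (u : V) (v : W) :
    ((G ⊕g H) ⊔ SimpleGraph.edge (Sum.inl u) (Sum.inr v)).chromaticNumber =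
      (max 2 (max m n) : ℕ) := by
  apply le_antisymm
  · have hGc := SimpleGraph.chromaticNumber_le_iff_colorable.1 hG.le
    have hHc := SimpleGraph.chromaticNumber_le_iff_colorable.1 hH.le
    obtain ⟨f⟩ := hGc.mono (show m ≤ max 2 (max m n) by omega)
    obtain ⟨g⟩ := hHc.mono (show n ≤ max 2 (max m n) by omega)
    have : Nontrivial (Fin (max 2 (max m n))) := Fin.nontrivial_iff_two_le.2 (le_max_left _ _)
    -- Exchanging the colours `g v` and `c` on the side of `v` separates `v` from `u`.
    obtain ⟨c, hc⟩ := exists_ne (f u)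
    refine SimpleGraph.Colorable.chromaticNumber_le ⟨SimpleGraph.Coloring.mk
      (Sum.elim f fun y => Equiv.swap (g v) c (g y)) ?_⟩
    rintro (x | x) (y | y) h
    · exact f.valid (by simpa [SimpleGraph.edge_adj, SimpleGraph.sum] using h)
    · obtain ⟨rfl, rfl⟩ : x = u ∧ y = v := by simpa [SimpleGraph.edge_adj, SimpleGraph.sum] using h
      simpa using hc.symm
    · obtain ⟨rfl, rfl⟩ : x = v ∧ y = u := by simpa [SimpleGraph.edge_adj, SimpleGraph.sum] using h
      simpa using hc
    · exact fun he => g.valid (v := x) (w := y)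
        (by simpa [SimpleGraph.edge_adj, SimpleGraph.sum] using h) ((Equiv.swap _ _).injective he)
  · have h₁ := SimpleGraph.chromaticNumber_mono (G := G ⊕g H)
      ((G ⊕g H) ⊔ SimpleGraph.edge (Sum.inl u) (Sum.inr v)) le_sup_left
    rw [SimpleGraph.chromaticNumber_sum, hG, hH] at h₁
    have h₂ : ((2 : ℕ) : ℕ∞) ≤
        ((G ⊕g H) ⊔ SimpleGraph.edge (Sum.inl u) (Sum.inr v)).chromaticNumber := by
      classical
      have := SimpleGraph.IsClique.card_le_chromaticNumber
        (G := (G ⊕g H) ⊔ SimpleGraph.edge (Sum.inl u) (Sum.inr v))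
        (s := {Sum.inl u, Sum.inr v})
        (by simp [SimpleGraph.isClique_iff, Set.Pairwise, SimpleGraph.edge_adj])
      rwa [Finset.card_pair (by simp)] at this
    rw [natCast_max, natCast_max]
    exact max_le h₂ h₁

end edges

/-- Adding a nonedge to the graph of a co-tree increases the chromatic number by one if the
nonedge is classified as frozen, and does not change it otherwise. -/
theorem chromaticNumber_sup_edge (t : CoTree) (u v : t.Vert) (h : u ≠ v)
    (hn : ¬ t.graph.Adj u v) : (t.graph ⊔ SimpleGraph.edge u v).chromaticNumber =
      (t.chi + if t.frozen u v = true then 1 else 0 : ℕ) := by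
  induction t with
  | leaf => exact absurd rfl h
  | union a b iha ihb =>
    have key : ∀ (u : a.Vert) (v : b.Vert), ((a.graph ⊕g b.graph) ⊔
        SimpleGraph.edge (Sum.inl u) (Sum.inr v)).chromaticNumber =
          (max a.chi b.chi + if (decide (a.chi = 1) && decide (b.chi = 1)) = true
            then 1 else 0 : ℕ) := fun u v => by
      have ha := one_le_chi a
      have hb := one_le_chi b
      rw [chromaticNumber_sum_sup_edge (chromaticNumber_graph a) (chromaticNumber_graph b)
        ha hb u v]
      simp only [Bool.and_eq_true, decide_eq_true_eq]
      congr 1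
      split_ifs <;> omega
    rcases u with u | u <;> rcases v with v | v
    · have ih := iha u v (fun h' => h (congrArg _ h')) hn
      refine (congrArg SimpleGraph.chromaticNumber (sum_sup_edge_inl u v)).trans ?_
      rw [SimpleGraph.chromaticNumber_sum, ih, chromaticNumber_graph, ← natCast_max]
      simp only [CoTree.chi, CoTree.frozen, Bool.and_eq_true, decide_eq_true_eq]
      congr 1
      -- The increase by one on this side survives the maximum iff this side attains it.
      generalize a.frozen u v = f
      cases f <;> by_cases h₁ : b.chi ≤ a.chi <;> simp [h₁] <;> omega
    · exact key u v
    · refine Eq.trans ?_ (key v u)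
      rw [SimpleGraph.edge_comm]
      rfl
    · have ih := ihb u v (fun h' => h (congrArg _ h')) hn
      refine (congrArg SimpleGraph.chromaticNumber (sum_sup_edge_inr u v)).trans ?_
      rw [SimpleGraph.chromaticNumber_sum, ih, chromaticNumber_graph, ← natCast_max]
      simp only [CoTree.chi, CoTree.frozen, Bool.and_eq_true, decide_eq_true_eq]
      congr 1
      generalize b.frozen u v = f
      cases f <;> by_cases h₁ : a.chi ≤ b.chi <;> simp [h₁] <;> omega
  | join a b iha ihb =>
    rcases u with u | u <;> rcases v with v | v
    · have ih := iha u v (fun h' => h (congrArg _ h')) hn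
      refine (congrArg SimpleGraph.chromaticNumber (join_sup_edge_inl u v)).trans
        ((chromaticNumber_graphJoin ih (chromaticNumber_graph b)).trans ?_)
      exact congrArg Nat.cast (Nat.add_right_comm _ _ _)
    · exact absurd trivial hn
    · exact absurd trivial hn
    · have ih := ihb u v (fun h' => h (congrArg _ h')) hn
      refine (congrArg SimpleGraph.chromaticNumber (join_sup_edge_inr u v)).trans
        ((chromaticNumber_graphJoin (chromaticNumber_graph a) ih).trans ?_)
      exact congrArg Nat.cast (Nat.add_assoc _ _ _).symm

theorem chiUnfrozenNonedge_congr {V W : Type*} {G : SimpleGraph V} {H : SimpleGraph W}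
    (φ : G ≃g H) (u v : V) : ChiUnfrozenNonedge H (φ u) (φ v) ↔ ChiUnfrozenNonedge G u v := by
  have ψ : (G ⊔ SimpleGraph.edge u v) ≃g (H ⊔ SimpleGraph.edge (φ u) (φ v)) :=
    ⟨φ.toEquiv, by
      intro x y
      change (H ⊔ _).Adj (φ x) (φ y) ↔ _
      simp only [sup_edge_adj, φ.map_adj_iff, ne_eq, EmbeddingLike.apply_eq_iff_eq]⟩
  rw [ChiUnfrozenNonedge, ChiUnfrozenNonedge, SimpleGraph.chromaticNumber_congr φ,
    SimpleGraph.chromaticNumber_congr ψ]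

theorem chiUnfrozenNonedge_graph {t : CoTree} {u v : t.Vert} (huv : u ≠ v)
    (hn : ¬ t.graph.Adj u v) : ChiUnfrozenNonedge t.graph u v ↔ t.frozen u v = false := by
  rw [ChiUnfrozenNonedge, chromaticNumber_sup_edge t u v huv hn, chromaticNumber_graph]
  cases t.frozen u v
  · simp
  · simp only [if_true, Nat.cast_inj, reduceCtorEq, iff_false]
    omega

end Cograph

theorem mainTheorem3 :
    GraphProblemInP {G : FinGraph | IsCograph G.2 ∧ ChiUnfrozen G.2} ∧
    ∀ {V : Type*} (G : SimpleGraph V) (t : CoTree) (φ : t.graph ≃g G) (u v : t.Vert),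
      u ≠ v → ¬ G.Adj (φ u) (φ v) →
        (t.frozen u v = true ↔ ChiFrozenNonedge G (φ u) (φ v)) ∧
        (t.frozen u v = false ↔ ChiUnfrozenNonedge G (φ u) (φ v)) := by
  refine ⟨Cograph.graphProblemInP_chiUnfrozen, fun G t φ u v huv hn => ?_⟩
  have h : ChiUnfrozenNonedge G (φ u) (φ v) ↔ t.frozen u v = false :=
    (Cograph.chiUnfrozenNonedge_congr φ u v).trans
      (Cograph.chiUnfrozenNonedge_graph huv (mt φ.map_adj_iff.2 hn))
  refine ⟨?_, h.symm⟩
  rw [← Bool.not_eq_false, ← h]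
  rfl
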